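/- **Setting.** Consider a Markov decision process with finite state space $\mathcal X$, finite action space $\mathcal A$, discount $\gamma\in[0,1)$, transition kernel $P:\mathcal X\times\mathcal A\to\mathscr P(\mathcal X)$, reward distributions $\mathcal R:\mathcal X\times\mathcal A\to\mathscr P(\mathbb R)$, and a set of terminal states, which are absorbing and have reward $0$. Let $\pi,\mu:\mathcal X\to\mathscr P(\mathcal A)$ be Markov policies and $\nu\in\mathscr P(\mathcal X\times\mathcal A)$. For a policy $\pi'$ let $Q^{\pi'}(x,a)=\mathbb E_{\pi'}\big[\sum_{t\ge0}\gamma^tR_t\,\big|\,X_0=x,A_0=a\big]$. For $\alpha\in[0,1]$ put $\pi^\alpha=\alpha\pi+(1-\alpha)\mu$, and with $\bar\rho_s=\min\big(1,\pi(A_s|X_s)/\mu(A_s|X_s)\big)$ let $$C(\alpha|x,a)=1-(1-\gamma)\,\mathbb E_\mu\Big[\sum_{t\ge0}\gamma^t\prod_{s=1}^t\big((1-\alpha)+\alpha\bar\rho_s\big)\,\Big|\,X_0=x,A_0=a\Big],\qquad C_\nu(\alpha)=\mathbb E_{(X,A)\sim\nu}[C(\alpha|X,A)].$$ Let $(x^{(k)}_t,a^{(k)}_t,r^{(k)}_t)_{t\ge0}$,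 $k\ge0$, be i.i.d. trajectories following $\mu$ with $(x^{(k)}_0,a^{(k)}_0)\sim\nu$, and let $T_k$ be the length of the $k$-th one, i.e. the time of its arrival in a terminal state. Let $\hat C^{(k)}(\alpha)=1-(1-\gamma)\sum_{t\ge0}\gamma^t\prod_{s=1}^t\big((1-\alpha)+\alpha\bar\rho^{(k)}_s\big)$, where $\bar\rho^{(k)}_s$ is $\bar\rho_s$ evaluated on trajectory $k$. Given stepsizes $\varepsilon_k\ge0$, a target rate $\Gamma$, $\phi_0\in\mathbb R$ and $Q_0:\mathcal X\times\mathcal A\to\mathbb R$ that is zero at terminal states, C-trace is the iteration, with $\alpha(\phi)=1/(1+e^{-\phi})$ and $\alpha_k=\alpha(\phi_k)$, $$\phi_{k+1}=\phi_k-\varepsilon_k\big(\hat C^{(k)}(\alpha_k)-\Gamma\big),$$ $$Q_{k+1}(x,a)=Q_k(x,a)+\varepsilon_k\sum_{0\le t<T_k}\mathbf 1\{(x^{(k)}_t,a^{(k)}_t)=(x,a)\}\sum_{s=t}^{T_k-1}\gamma^{s-t}\Big(\prod_{u=t+1}^{s}\min\Big(1,\tfrac{\pi^{\alpha_k}(a^{(k)}_u|x^{(k)}_u)}{\mu(a^{(k)}_u|x^{(k)}_u)}\Big)\Big)\Delta^{(k)}_s,$$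 $$\Delta^{(k)}_s=r^{(k)}_s+\gamma\sum_{a'}\pi^{\alpha_k}(a'|x^{(k)}_{s+1})\,Q_k(x^{(k)}_{s+1},a')-Q_k(x^{(k)}_s,a^{(k)}_s).$$ **Theorem.** Assume that $0<\Gamma\le C_\nu(1)$, that $\sum_k\varepsilon_k=\infty$ and $\sum_k\varepsilon_k^2<\infty$, that $\mathbb E[T_0^2]<\infty$, that the rewards are bounded, and that every pair $(x,a)$ with $x$ non-terminal has positive probability of being visited by a trajectory. Then there is a unique $\alpha^*\in[0,1]$ with $C_\nu(\alpha^*)=\Gamma$; it is positive, and if $\Gamma<C_\nu(1)$, then $\alpha^*=\alpha(\phi^*)$ for the unique $\phi^*\in\mathbb R$ with $C_\nu(\alpha(\phi^*))=\Gamma$. Moreover, almost surely, $$\alpha(\phi_k)\to\alpha^*\qquad\text{and}\qquad Q_k\to Q^{\alpha^*\pi+(1-\alpha^*)\mu}.$$ -/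

import Mathlib

open MeasureTheory ProbabilityTheory Filter Topology
open scoped ENNReal unitInterval

noncomputable section

namespace CTrace

/-- A discounted episodic Markov decision process on the state space `X` and the action space `A`.
As usual, the end of an episode is the arrival in a terminal state: terminal states are absorbing
and yield reward `0`. -/
structure EpisodicMDP (X A : Type*) where
  /-- The discount factor. -/
  γ : ℝ
  γ_nonneg : 0 ≤ γ
  γ_lt_one : γ < 1
  /-- The transition kernel. -/
  P : X → A → PMF X
  /-- The reward distributions. -/
  reward : X → A → ProbabilityMeasure ℝ
  /-- The set of terminal states. -/
  terminal : Set X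
  P_terminal : ∀ x ∈ terminal, ∀ a, P x a = PMF.pure x
  reward_terminal : ∀ x ∈ terminal, ∀ a, (reward x a : Measure ℝ) = Measure.dirac 0

/-- A Markov policy. -/
abbrev Policy (X A : Type*) := X → PMF A

/-- An infinite trajectory `(x_t, a_t, r_t)_{t ≥ 0}`. -/
abbrev Traj (X A : Type*) := ℕ → X × A × ℝ

section Policies

variable {X A : Type*}

/-- The mixture `α π + (1 - α) μ`. -/
def mix (α : I) (π μ : Policy X A) : Policy X A := fun x =>
  ⟨fun a => ENNReal.ofReal (α : ℝ) * π x a + ENNReal.ofReal (1 - (α : ℝ)) * μ x a, by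
    have h : ENNReal.ofReal (α : ℝ) * 1 + ENNReal.ofReal (1 - (α : ℝ)) * 1 = 1 := by
      rw [mul_one, mul_one, ← ENNReal.ofReal_add α.2.1 (by linarith [α.2.2])]
      simp
    have hs : ∑' a, (ENNReal.ofReal (α : ℝ) * π x a + ENNReal.ofReal (1 - (α : ℝ)) * μ x a) = 1 := by
      rw [ENNReal.tsum_add, ENNReal.tsum_mul_left, ENNReal.tsum_mul_left, (π x).tsum_coe,
        (μ x).tsum_coe, h]
    exact hs ▸ ENNReal.summable.hasSum⟩

/-- The truncated importance weight `min (1, π(a|x) / μ(a|x))`. -/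
def truncWeight (π μ : Policy X A) (x : X) (a : A) : ℝ :=
  min 1 ((π x a).toReal / (μ x a).toReal)

end Policies

section Law

variable {X A : Type*} [Countable X] [Countable A] [MeasurableSpace X] [MeasurableSpace A]
  [MeasurableSingletonClass X] [MeasurableSingletonClass A]

/-- The law of the next state-action pair, under the policy `μ`. -/
def nextPair (M : EpisodicMDP X A) (μ : Policy X A) (z : X × A) : PMF (X × A) :=
  (M.P z.1 z.2).bind fun x' => (μ x').map (Prod.mk x')

/-- The kernel `(x, a) ↦ law of (x', a')`. -/
def pairKernel (M : EpisodicMDP X A) (μ : Policy X A) : Kernel (X × A) (X × A) :=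
  Kernel.ofFunOfCountable fun z => (nextPair M μ z).toMeasure

instance (M : EpisodicMDP X A) (μ : Policy X A) : IsMarkovKernel (pairKernel M μ) :=
  ⟨fun z => inferInstanceAs (IsProbabilityMeasure (nextPair M μ z).toMeasure)⟩

/-- The kernel `(x, a) ↦ law of (x, a, r)` with `r` drawn from the reward distribution
of `(x, a)`. -/
def emitKernel (M : EpisodicMDP X A) : Kernel (X × A) (X × A × ℝ) :=
  Kernel.ofFunOfCountable fun z => (M.reward z.1 z.2 : Measure ℝ).map fun r => (z.1, z.2, r)

instance (M : EpisodicMDP X A) : IsMarkovKernel (emitKernel M) :=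
  ⟨fun z => Measure.isProbabilityMeasure_map (μ := (M.reward z.1 z.2 : Measure ℝ))
    (f := fun r => (z.1, z.2, r)) (by fun_prop)⟩

/-- One step of the process `(X_t, A_t, R_t)` under the policy `μ`. -/
def stepKernel (M : EpisodicMDP X A) (μ : Policy X A) : Kernel (X × A × ℝ) (X × A × ℝ) :=
  (emitKernel M ∘ₖ pairKernel M μ).comap (fun s => (s.1, s.2.1)) (by fun_prop)

instance (M : EpisodicMDP X A) (μ : Policy X A) : IsMarkovKernel (stepKernel M μ) := by
  unfold stepKernel; infer_instance

/-- The law of the trajectory `(X_t, A_t, R_t)_{t ≥ 0}` generated by following the policy `μ` from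
an initial state-action pair with distribution `ν`. -/
def trajLaw (M : EpisodicMDP X A) (μ : Policy X A) (ν : PMF (X × A)) : Measure (Traj X A) :=
  Kernel.trajMeasure (X := fun _ => X × A × ℝ) (emitKernel M ∘ₘ ν.toMeasure)
    fun n => (stepKernel M μ).comap (fun h => h ⟨n, by simp⟩) (by fun_prop)

/-- `Q^π(x, a)`, the expected discounted return of `π` from `(x, a)`. -/
def qValue (M : EpisodicMDP X A) (π : Policy X A) (x : X) (a : A) : ℝ :=
  ∫ τ, ∑' t : ℕ, M.γ ^ t * (τ t).2.2 ∂(trajLaw M π (PMF.pure (x, a)))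

/-- The contraction rate estimate from a single trajectory,
`1 - (1 - γ) ∑_t γ^t ∏_{s=1}^t ((1 - α) + α min (1, π(a_s|x_s) / μ(a_s|x_s)))`. -/
def contractionEst (M : EpisodicMDP X A) (π μ : Policy X A) (α : I) (τ : Traj X A) : ℝ :=
  1 - (1 - M.γ) * ∑' t : ℕ, M.γ ^ t *
    ∏ s ∈ Finset.Icc 1 t, ((1 - (α : ℝ)) + (α : ℝ) * truncWeight π μ (τ s).1 (τ s).2.1)

/-- The contraction rate `C(α|x, a)` of the mixture Retrace operator at the pair `(x, a)`. -/
def contractionRate (M : EpisodicMDP X A) (π μ : Policy X A) (α : I) (x : X) (a : A) : ℝ :=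
  1 - (1 - M.γ) * ∫ τ, ∑' t : ℕ, M.γ ^ t *
    ∏ s ∈ Finset.Icc 1 t, ((1 - (α : ℝ)) + (α : ℝ) * truncWeight π μ (τ s).1 (τ s).2.1)
      ∂(trajLaw M μ (PMF.pure (x, a)))

/-- The averaged contraction rate `C_ν(α)`. -/
def avgContractionRate (M : EpisodicMDP X A) (π μ : Policy X A) (ν : PMF (X × A)) (α : I) : ℝ :=
  ∫ z, contractionRate M π μ α z.1 z.2 ∂ν.toMeasure

end Law

section Algorithm

variable {X A : Type*}

/-- The length of a trajectory: the time of arrival in a terminal state (`⊤` if there is none). -/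
def trajLength (M : EpisodicMDP X A) (τ : Traj X A) : ℕ∞ :=
  ⨅ (t : ℕ) (_ : (τ t).1 ∈ M.terminal), (t : ℕ∞)

/-- The temporal difference error
`Δ_s = r_s + γ ∑_a π(a|x_{s+1}) Q(x_{s+1}, a) - Q(x_s, a_s)`. -/
def tdError [Fintype A] (M : EpisodicMDP X A) (π : Policy X A) (Q : X → A → ℝ) (τ : Traj X A)
    (s : ℕ) : ℝ :=
  (τ s).2.2 + M.γ * ∑ a, (π (τ (s + 1)).1 a).toReal * Q (τ (s + 1)).1 a - Q (τ s).1 (τ s).2.1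

/-- The Retrace increment at time `t`,
`∑_{t ≤ s < T} γ^{s-t} (∏_{u=t+1}^s min (1, π(a_u|x_u) / μ(a_u|x_u))) Δ_s`,
where `T` is the trajectory length; the Retrace target for the pair visited at time `t` is its
current value plus this increment. -/
def retraceIncrement [Fintype A] (M : EpisodicMDP X A) (π μ : Policy X A) (Q : X → A → ℝ)
    (τ : Traj X A) (t : ℕ) : ℝ :=
  ∑ s ∈ Finset.Ico t (trajLength M τ).toNat, M.γ ^ (s - t) *
    (∏ u ∈ Finset.Ioc t s, truncWeight π μ (τ u).1 (τ u).2.1) * tdError M π Q τ s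

open Classical in
/-- The result of applying to `Q` the (offline, every-visit) Retrace updates with target policy `π`,
behaviour policy `μ` and stepsize `ε`, for all the state-action pairs visited along the
trajectory `τ`. -/
def retraceUpdate [Fintype A] (M : EpisodicMDP X A) (π μ : Policy X A) (ε : ℝ) (Q : X → A → ℝ)
    (τ : Traj X A) : X → A → ℝ := fun x a =>
  Q x a + ε * ∑ t ∈ Finset.range (trajLength M τ).toNat,
    if (τ t).1 = x ∧ (τ t).2.1 = a then retraceIncrement M π μ Q τ t else 0

/-- The Robbins-Monro iterates `φ_{k+1} = φ_k - ε_k (Ĉ^{(k)}(σ(φ_k)) - Γ)`, `σ` the sigmoid, run on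
the sequence of trajectories `w`. -/
def phiSeq (M : EpisodicMDP X A) (π μ : Policy X A) (Γ : ℝ) (ε : ℕ → ℝ) (φ₀ : ℝ)
    (w : ℕ → Traj X A) : ℕ → ℝ
  | 0 => φ₀
  | k + 1 =>
    phiSeq M π μ Γ ε φ₀ w k -
      ε k * (contractionEst M π μ (unitInterval.sigmoid (phiSeq M π μ Γ ε φ₀ w k)) (w k) - Γ)

/-- The C-trace iterates: `Q_{k+1}` is obtained from `Q_k` by the Retrace updates targeting
`σ(φ_k) π + (1 - σ(φ_k)) μ`. The trajectories are numbered from `0`, so that the trajectory `w k`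
used for `Q_{k+1}` is the `(k+1)`-st one. -/
def qSeq [Fintype A] (M : EpisodicMDP X A) (π μ : Policy X A) (Γ : ℝ) (ε : ℕ → ℝ) (φ₀ : ℝ)
    (Q₀ : X → A → ℝ) (w : ℕ → Traj X A) : ℕ → X → A → ℝ
  | 0 => Q₀
  | k + 1 =>
    retraceUpdate M (mix (unitInterval.sigmoid (phiSeq M π μ Γ ε φ₀ w k)) π μ) μ (ε k)
      (qSeq M π μ Γ ε φ₀ Q₀ w k) (w k)

end Algorithm

end CTrace

end

/-! The averaged rate is continuous in `α` and vanishes at `0`. It is strictly increasing as soon as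
it is positive at `1`: the trace products are antitone in `α`, and equal expectations at two
parameters would make the full trace with `α = 1` a plain geometric series almost surely, so the
rate at `1` would be zero (`strictMono_avgContractionRate`). The intermediate value theorem gives
`α*`. The single-trajectory estimate has this rate as its mean, so the iteration for `φ` is a scalar
Robbins-Monro scheme with monotone drift and bounded noise; `tendsto_sigmoid_of_robbinsMonro` treats
it on the sigmoid scale, so that `α* = 1`, where no finite root exists, needs no separate treatment.

For the action values, let `W` be the one-step mean under `μ` weighted by the truncated ratios. The
increments of a non-terminal pair, summed over one trajectory, have as mean the expected number of
visits times the Neumann series of `γW` applied to the Bellman residual (`integral_updateSum`).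
Adding `Q` to that series gives the Retrace operator. Since `μ` times the truncated ratio is at most
the target policy, it contracts in sup norm with factor `γ` (`abs_retrace_contraction`), and
measuring distances from the value of `α*` instead of `α_k` costs an error of order `|α_k - α*|`
(`abs_retrace_sub_qValue_le`). Thus `Q_k` is a stochastic approximation driven by a
pseudo-contraction with vanishing perturbation and positive speed in each coordinate.

The difficulty is that the noise grows with `‖Q_k‖`, which is not known to be bounded. It is
therefore divided by the running maximum of `1 + ‖Q_j‖`. The quotient is dominated by a multiple of
the trajectory length, which is square integrable, so its weighted sums form an L²-bounded
martingale and converge almost surely (`ae_exists_tendsto_noise`). The rest is deterministic, path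
by path: convergence of the normalized noise bounds the iterates (`bounded_of_normalized_noise`),
then the true noise is summable too (`cauchySeq_series_mul_of_monotone_bounded`), and
`tendsto_zero_of_contraction` gives the limit. -/

noncomputable section

namespace CTrace

/-! ### Deterministic stochastic-approximation lemmas -/

section Deterministic

/-- Discrete Gronwall lemma with divergent stepsizes. -/
lemma tendsto_zero_of_recursion {a ε e : ℕ → ℝ} {c C : ℝ} (hc : 0 < c)
    (ha : ∀ k, 0 ≤ a k) (hε0 : ∀ k, 0 ≤ ε k) (hε : Tendsto ε atTop (𝓝 0)) (hε1 : ¬ Summable ε)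
    (he : Tendsto e atTop (𝓝 0))
    (hrec : ∀ᶠ k in atTop, a (k + 1) ≤ (1 - c * ε k) * a k + C * ε k * e k) :
    Tendsto a atTop (𝓝 0) := by
  rw [Metric.tendsto_atTop]
  intro δ hδ
  have h1 : ∀ᶠ k in atTop, C * e k < c * (δ / 2) := by
    have : Tendsto (fun k => C * e k) atTop (𝓝 (C * 0)) := he.const_mul C
    rw [mul_zero] at this
    exact this.eventually (gt_mem_nhds (by positivity))
  have h2 : ∀ᶠ k in atTop, c * ε k < 1 := by
    have : Tendsto (fun k => c * ε k) atTop (𝓝 (c * 0)) := hε.const_mul c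
    rw [mul_zero] at this
    exact this.eventually (gt_mem_nhds (by positivity))
  obtain ⟨K, hK⟩ := eventually_atTop.1 (h1.and (h2.and hrec))
  -- Past `K` the perturbation is below `c * (δ / 2)` per unit of stepsize, so each step shrinks the
  -- excess of `a` over `δ / 2` by the factor `1 - c * ε ≤ exp (-c * ε)`.
  have hstep : ∀ n, max (a (K + n) - δ / 2) 0 ≤
      Real.exp (-c * ∑ j ∈ Finset.range n, ε (K + j)) * max (a K - δ / 2) 0 := by
    intro n
    induction n with
    | zero => simp
    | succ n ih =>
      obtain ⟨g1, g2, g3⟩ := hK (K + n) (by omega)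
      have g0 := hε0 (K + n)
      have hexp : 1 - c * ε (K + n) ≤ Real.exp (-c * ε (K + n)) := by
        have := Real.add_one_le_exp (-c * ε (K + n)); linarith
      have hb : max (a (K + n + 1) - δ / 2) 0 ≤
          (1 - c * ε (K + n)) * max (a (K + n) - δ / 2) 0 := by
        refine max_le ?_ (mul_nonneg (by linarith) (le_max_right _ _))
        have : (1 - c * ε (K + n)) * (a (K + n) - δ / 2) ≤
            (1 - c * ε (K + n)) * max (a (K + n) - δ / 2) 0 :=
          mul_le_mul_of_nonneg_left (le_max_left _ _) (by linarith)
        have h3 := mul_le_mul_of_nonneg_left g1.le g0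
        nlinarith
      calc max (a (K + (n + 1)) - δ / 2) 0
          ≤ (1 - c * ε (K + n)) * max (a (K + n) - δ / 2) 0 := hb
        _ ≤ Real.exp (-c * ε (K + n)) * max (a (K + n) - δ / 2) 0 :=
            mul_le_mul_of_nonneg_right hexp (le_max_right _ _)
        _ ≤ Real.exp (-c * ε (K + n)) *
            (Real.exp (-c * ∑ j ∈ Finset.range n, ε (K + j)) * max (a K - δ / 2) 0) :=
            mul_le_mul_of_nonneg_left ih (Real.exp_nonneg _)
        _ = _ := by
            rw [← mul_assoc, ← Real.exp_add, Finset.sum_range_succ]; ring_nf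
  have hdiv : Tendsto (fun n => ∑ j ∈ Finset.range n, ε (K + j)) atTop atTop := by
    refine (not_summable_iff_tendsto_nat_atTop_of_nonneg fun n => hε0 _).1 ?_
    intro h
    refine hε1 ((summable_nat_add_iff K).1 ?_)
    simpa [add_comm] using h
  have hlim : Tendsto (fun n => Real.exp (-c * ∑ j ∈ Finset.range n, ε (K + j)) *
      max (a K - δ / 2) 0) atTop (𝓝 0) := by
    have : Tendsto (fun n => -c * ∑ j ∈ Finset.range n, ε (K + j)) atTop atBot :=
      hdiv.const_mul_atTop_of_neg (by linarith)
    simpa using (Real.tendsto_exp_atBot.comp this).mul_const (max (a K - δ / 2) 0)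
  obtain ⟨N, hN⟩ := eventually_atTop.1 (hlim.eventually (gt_mem_nhds (half_pos hδ)))
  refine ⟨K + N, fun k hk => ?_⟩
  obtain ⟨n, rfl⟩ : ∃ n, k = K + n := ⟨k - K, by omega⟩
  have := (le_max_left _ _).trans_lt ((hstep n).trans_lt (hN n (by omega)))
  rw [Real.dist_eq, sub_zero, abs_of_nonneg (ha _)]
  linarith

/-- One-sided convergence of the Robbins-Monro iteration. -/
lemma eventually_ge_of_robbinsMonro {φ v ε N : ℕ → ℝ} {a c C L : ℝ} (hc : 0 < c)
    (hε0 : ∀ k, 0 ≤ ε k) (hε : Tendsto ε atTop (𝓝 0)) (hε1 : ¬ Summable ε)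
    (hN : Tendsto (fun n => ∑ k ∈ Finset.range n, N k) atTop (𝓝 L))
    (hrec : ∀ k, φ (k + 1) = φ k + ε k * v k + N k) (hv : ∀ k, |v k| ≤ C)
    (hva : ∀ k, φ k ≤ a → c ≤ v k) {δ : ℝ} (hδ : 0 < δ) :
    ∀ᶠ k in atTop, a - δ ≤ φ k := by
  -- The remaining noise `S` tends to `0`, and adding it to `φ` cancels the noise: `ψ` moves by the
  -- drift alone.
  set S : ℕ → ℝ := fun n => L - ∑ k ∈ Finset.range n, N k with hS
  have hS0 : Tendsto S atTop (𝓝 0) := by simpa [hS] using hN.const_sub L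
  have hSs : ∀ k, S (k + 1) = S k - N k := fun k => by
    simp only [hS, Finset.sum_range_succ]; ring
  set ψ : ℕ → ℝ := fun n => φ n + S n with hψ
  have hψs : ∀ k, ψ (k + 1) = ψ k + ε k * v k := fun k => by
    simp only [hψ, hSs, hrec]; ring
  have h1 : ∀ᶠ k in atTop, |S k| < δ / 4 := by
    have := hS0.abs; rw [abs_zero] at this
    exact this.eventually (gt_mem_nhds (by positivity))
  have h2 : ∀ᶠ k in atTop, ε k * C < δ / 4 := by
    have := hε.mul_const C; rw [zero_mul] at this
    exact this.eventually (gt_mem_nhds (by positivity))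
  obtain ⟨K, hK⟩ := eventually_atTop.1 (h1.and h2)
  have hup : ∀ k, K ≤ k → ψ k < a - δ / 4 → c ≤ v k := fun k hk h => by
    apply hva
    have := (abs_lt.1 (hK k hk).1).1
    simp only [hψ] at h
    linarith
  -- Below `a - δ / 4` the drift pushes upwards; above it, a single step loses less than `δ / 4`.
  have hstay : ∀ k, K ≤ k → a - δ / 2 ≤ ψ k → a - δ / 2 ≤ ψ (k + 1) := fun k hk h => by
    rw [hψs]
    by_cases h' : ψ k < a - δ / 4
    · have := mul_nonneg (hε0 k) (hc.le.trans (hup k hk h'))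
      linarith
    · have h3 := mul_le_mul_of_nonneg_left (neg_le_of_abs_le (hv k)) (hε0 k)
      have h4 := (hK k hk).2
      push Not at h'
      linarith
  -- Staying below the level forever would mean a drift of at least `c` at all times, and the
  -- stepsizes have infinite sum.
  obtain ⟨k₀, hk₀, hk₁⟩ : ∃ k, K ≤ k ∧ a - δ / 2 ≤ ψ k := by
    by_contra! hcon
    have hlow : ∀ n, ψ K + c * ∑ j ∈ Finset.range n, ε (K + j) ≤ ψ (K + n) := by
      intro n
      induction n with
      | zero => simp
      | succ n ih =>
        have h3 := hup (K + n) (by omega) (by linarith [hcon (K + n) (by omega)])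
        have h4 := mul_le_mul_of_nonneg_left h3 (hε0 (K + n))
        rw [← add_assoc, hψs, Finset.sum_range_succ]
        linarith
    have hdiv : Tendsto (fun n => ∑ j ∈ Finset.range n, ε (K + j)) atTop atTop := by
      refine (not_summable_iff_tendsto_nat_atTop_of_nonneg fun n => hε0 _).1 ?_
      intro h
      refine hε1 ((summable_nat_add_iff K).1 ?_)
      simpa [add_comm] using h
    have := tendsto_atTop_add_const_left atTop (ψ K) (hdiv.const_mul_atTop hc)
    obtain ⟨n, hn⟩ := (this.eventually (eventually_ge_atTop (a - δ / 2))).exists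
    exact absurd (hn.trans (hlow n)) (not_le.2 (hcon (K + n) (by omega)))
  refine eventually_atTop.2 ⟨k₀, fun k hk => ?_⟩
  have h5 : a - δ / 2 ≤ ψ k := by
    induction k, hk using Nat.le_induction with
    | base => exact hk₁
    | succ k hk ih => exact hstay k (hk₀.trans hk) ih
  have := (abs_lt.1 (hK k (hk₀.trans hk)).1).2
  simp only [hψ] at h5
  linarith

lemma abs_convex_comb_le {t u v M : ℝ} (h0 : 0 ≤ t) (h1 : t ≤ 1) (hu : |u| ≤ M) (hv : |v| ≤ M) :
    |(1 - t) * u + t * v| ≤ M := by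
  rw [abs_le] at *
  constructor <;> nlinarith

/-- A stochastic-approximation iteration driven by a sup-norm pseudo-contraction stays bounded, when
the noise, normalized by the running maximum of the norms of the iterates, is summable. -/
lemma bounded_of_normalized_noise {ι : Type*} [Fintype ι] {q F n : ℕ → ι → ℝ} {d : ι → ℝ}
    {ε G : ℕ → ℝ} {γ E : ℝ} (hd : ∀ i, 0 < d i) (hγ0 : 0 ≤ γ) (hγ1 : γ < 1)
    (hε0 : ∀ k, 0 ≤ ε k) (hε : Tendsto ε atTop (𝓝 0)) (hqG : ∀ k, 1 + ‖q k‖ ≤ G k)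
    (hG : ∀ k, G (k + 1) ≤ max (G k) (1 + ‖q (k + 1)‖)) (hGm : Monotone G)
    (hF : ∀ k i, |F k i| ≤ γ * ‖q k‖ + E)
    (hrec : ∀ k i, q (k + 1) i = q k i + ε k * (d i * (F k i - q k i)) + G k * n k i)
    (hn : ∀ i, CauchySeq fun m => ∑ k ∈ Finset.range m, n k i) : ∃ B, ∀ k, G k ≤ B := by
  -- The noise enters the bounds with total weight `4 * δ`, half of the contraction gap `1 - γ`.
  set δ := (1 - γ) / 8 with hδ
  have hδ0 : 0 < δ := by rw [hδ]; linarith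
  have h1 : ∀ᶠ K in atTop, ∀ i, ∀ m ≥ K,
      |∑ k ∈ Finset.range m, n k i - ∑ k ∈ Finset.range K, n k i| ≤ δ := by
    rw [eventually_all]
    intro i
    obtain ⟨K, hK⟩ := Metric.cauchySeq_iff.1 (hn i) δ hδ0
    exact eventually_atTop.2 ⟨K, fun k hk m hm => (hK m (hk.trans hm) k hk).le⟩
  have h2 : ∀ᶠ K in atTop, ∀ i, ε K * d i ≤ 1 := by
    rw [eventually_all]
    intro i
    have := hε.mul_const (d i)
    rw [zero_mul] at this
    exact (this.eventually (gt_mem_nhds one_pos)).mono fun _ h => h.le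
  obtain ⟨K, hK⟩ := eventually_atTop.1 (h1.and h2)
  set U : ℕ → ι → ℝ := fun l i => ∑ k ∈ Finset.range (K + l), n k i - ∑ k ∈ Finset.range K, n k i
    with hU
  have hUs : ∀ l i, U (l + 1) i = U l i + n (K + l) i := fun l i => by
    simp only [hU, ← add_assoc, Finset.sum_range_succ]; ring
  have hUδ : ∀ l i, |U l i| ≤ δ := fun l i => (hK K le_rfl).1 i (K + l) (by omega)
  set S : ℕ → ι → ℝ := fun l i => ∑ k ∈ Finset.range l, G (K + k) * n (K + k) i with hS
  have hSs : ∀ l i, S (l + 1) i = S l i + G (K + l) * n (K + l) i := fun l i => by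
    simp only [hS, Finset.sum_range_succ]
  have hG0 : ∀ k, 0 ≤ G k := fun k => le_trans (by positivity) (hqG k)
  -- Summation by parts: the difference is a sum of increments of the monotone `G` against partial
  -- sums `U` that stay within `δ`.
  have hSU : ∀ l i, |S l i - G (K + l) * U l i| ≤ δ * (G (K + l) - G K) := by
    intro l i
    induction l with
    | zero => simp [hS, hU]
    | succ l ih =>
      have e1 : S (l + 1) i - G (K + (l + 1)) * U (l + 1) i =
          (S l i - G (K + l) * U l i) - (G (K + l + 1) - G (K + l)) * U (l + 1) i := by
        rw [hSs, hUs, ← add_assoc]; ring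
      have e2 : 0 ≤ G (K + l + 1) - G (K + l) := sub_nonneg.2 (hGm (by omega))
      rw [e1]
      refine (abs_sub _ _).trans ?_
      rw [abs_mul, abs_of_nonneg e2, ← add_assoc]
      have := mul_le_mul_of_nonneg_left (hUδ (l + 1) i) e2
      linarith
  have hS1 : ∀ l i, |S l i| ≤ 2 * δ * G (K + l) := fun l i => by
    have e1 := hSU l i
    have e2 : |G (K + l) * U l i| ≤ G (K + l) * δ := by
      rw [abs_mul, abs_of_nonneg (hG0 _)]
      exact mul_le_mul_of_nonneg_left (hUδ l i) (hG0 _)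
    have e3 := abs_add_le (S l i - G (K + l) * U l i) (G (K + l) * U l i)
    rw [sub_add_cancel] at e3
    have := mul_nonneg hδ0.le (hG0 K)
    linarith
  -- The bound has to be in terms of `G (K + l)`: in the induction below, `G (K + l + 1)` is not yet
  -- known to be at most `B`.
  have hS2 : ∀ l i, |S (l + 1) i| ≤ 2 * δ * G (K + l) := fun l i => by
    have e1 := hSU l i
    have e0 : S (l + 1) i = (S l i - G (K + l) * U l i) + G (K + l) * U (l + 1) i := by
      rw [hSs, hUs]; ring
    have e2 : |G (K + l) * U (l + 1) i| ≤ G (K + l) * δ := by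
      rw [abs_mul, abs_of_nonneg (hG0 _)]
      exact mul_le_mul_of_nonneg_left (hUδ _ i) (hG0 _)
    have e3 := abs_add_le (S l i - G (K + l) * U l i) (G (K + l) * U (l + 1) i)
    rw [← e0] at e3
    have := mul_nonneg hδ0.le (hG0 K)
    linarith
  -- The first entry starts the induction; the second makes `γ * B + E + 2 * δ * B ≤ (1 - 2 * δ) * B
  -- - 1`, so the noise-free part `q - S` keeps its bound under the convex-combination step.
  set B := max (2 * (G K)) ((E + 1) / (1 - γ - 4 * δ)) with hB
  have hγδ : 0 < 1 - γ - 4 * δ := by rw [hδ]; linarith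
  have hB1 : 2 * G K ≤ B := le_max_left _ _
  have hB2 : E + 1 ≤ B * (1 - γ - 4 * δ) := (div_le_iff₀ hγδ).1 (le_max_right _ _)
  have hGK := hqG K
  have hB0 : 0 ≤ B := by linarith [hG0 K]
  have key : ∀ l, G (K + l) ≤ B ∧ ∀ i, |q (K + l) i - S l i| ≤ (1 - 2 * δ) * B - 1 := by
    intro l
    induction l with
    | zero =>
      refine ⟨by simp only [add_zero]; linarith [hG0 K], fun i => ?_⟩
      have e1 : |q K i| ≤ ‖q K‖ := norm_le_pi_norm (q K) i
      have e2 : 2 * δ ≤ 1 / 2 := by rw [hδ]; linarith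
      have e3 := mul_le_mul_of_nonneg_right e2 hB0
      simp only [add_zero, hS, Finset.range_zero, Finset.sum_empty, sub_zero]
      linarith
    | succ l ih =>
      obtain ⟨ih1, ih2⟩ := ih
      have hz : ∀ i, |q (K + (l + 1)) i - S (l + 1) i| ≤ (1 - 2 * δ) * B - 1 := by
        intro i
        have e1 : q (K + (l + 1)) i - S (l + 1) i =
            (1 - ε (K + l) * d i) * (q (K + l) i - S l i) +
              (ε (K + l) * d i) * (F (K + l) i - S l i) := by
          rw [hSs, ← add_assoc, hrec]; ring
        rw [e1]
        refine abs_convex_comb_le (mul_nonneg (hε0 _) (hd i).le) ((hK (K + l) (by omega)).2 i)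
          (ih2 i) ?_
        refine (abs_sub _ _).trans ?_
        have e2 := hF (K + l) i
        have e3 := hS1 l i
        have e4 : γ * ‖q (K + l)‖ ≤ γ * B :=
          mul_le_mul_of_nonneg_left (by linarith [hqG (K + l)]) hγ0
        have e5 : 2 * δ * G (K + l) ≤ 2 * δ * B := mul_le_mul_of_nonneg_left ih1 (by linarith)
        linarith
      refine ⟨(hG (K + l)).trans (max_le ih1 ?_), hz⟩
      have : ‖q (K + l + 1)‖ ≤ B - 1 := by
        refine (pi_norm_le_iff_of_nonneg (by linarith [hG0 K, hqG K, norm_nonneg (q K)])).2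
          fun i => ?_
        have e1 := hz i
        have e2 := hS2 l i
        have e3 := abs_add_le (q (K + (l + 1)) i - S (l + 1) i) (S (l + 1) i)
        have e5 : 2 * δ * G (K + l) ≤ 2 * δ * B := mul_le_mul_of_nonneg_left ih1 (by linarith)
        rw [sub_add_cancel, ← add_assoc] at e3
        rw [Real.norm_eq_abs]
        rw [← add_assoc] at e1
        linarith
      linarith
  exact ⟨B, fun k => (hGm (by omega : k ≤ K + k)).trans (key k).1⟩

/-- Abel's test: with `L` the limit of `G`, the factor `G - L` is monotone and tends to `0`, so
Dirichlet's test applies to it, and `L` times the original series converges. -/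
lemma cauchySeq_series_mul_of_monotone_bounded {G n : ℕ → ℝ} {B : ℝ} (hGm : Monotone G)
    (hGB : ∀ k, G k ≤ B) (hn : CauchySeq fun m => ∑ k ∈ Finset.range m, n k) :
    CauchySeq fun m => ∑ k ∈ Finset.range m, G k * n k := by
  have hb : BddAbove (Set.range G) := ⟨B, by rintro _ ⟨k, rfl⟩; exact hGB k⟩
  have hlim := tendsto_atTop_ciSup hGm hb
  set L := ⨆ k, G k
  obtain ⟨R, hR⟩ := hn.norm_bddAbove
  have h1 : CauchySeq fun m => ∑ k ∈ Finset.range m, (G k - L) * n k := by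
    have := Monotone.cauchySeq_series_mul_of_tendsto_zero_of_bounded (f := fun k => G k - L)
      (z := n) (b := R) (fun a b h => sub_le_sub_right (hGm h) L)
      (by simpa using hlim.sub_const L) (fun m => hR ⟨m, rfl⟩)
    simpa [smul_eq_mul] using this
  obtain ⟨l₁, hl₁⟩ := cauchySeq_tendsto_of_complete h1
  obtain ⟨l₂, hl₂⟩ := cauchySeq_tendsto_of_complete hn
  refine ((hl₁.add (hl₂.const_mul L)).congr fun m => ?_).cauchySeq
  rw [Finset.mul_sum, ← Finset.sum_add_distrib]
  exact Finset.sum_congr rfl fun k _ => by ring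

/-- Convergence of a stochastic-approximation iteration driven by a sup-norm pseudo-contraction with
vanishing perturbations, when the noise is summable. -/
lemma tendsto_zero_of_contraction {ι : Type*} [Fintype ι] {x F N : ℕ → ι → ℝ} {d : ι → ℝ}
    {ε e : ℕ → ℝ} {γ : ℝ} (hd : ∀ i, 0 < d i) (hγ0 : 0 ≤ γ) (hγ1 : γ < 1)
    (hε0 : ∀ k, 0 ≤ ε k) (hε : Tendsto ε atTop (𝓝 0)) (hε1 : ¬ Summable ε)
    (he : Tendsto e atTop (𝓝 0)) (he0 : ∀ k, 0 ≤ e k)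
    (hF : ∀ k i, |F k i| ≤ γ * ‖x k‖ + e k)
    (hrec : ∀ k i, x (k + 1) i = x k i + ε k * (d i * (F k i - x k i)) + N k i)
    (hN : ∀ i, CauchySeq fun m => ∑ k ∈ Finset.range m, N k i) : Tendsto x atTop (𝓝 0) := by
  choose L hL using fun i => cauchySeq_tendsto_of_complete (hN i)
  set S : ℕ → ι → ℝ := fun n i => L i - ∑ k ∈ Finset.range n, N k i with hS
  have hS0 : Tendsto S atTop (𝓝 0) := by
    rw [tendsto_pi_nhds]
    intro i
    simpa [hS] using (hL i).const_sub (L i)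
  have hSs : ∀ k i, S (k + 1) i = S k i - N k i := fun k i => by
    simp only [hS, Finset.sum_range_succ]; ring
  suffices h : Tendsto (fun k => ‖x k + S k‖) atTop (𝓝 0) by
    have := (tendsto_zero_iff_norm_tendsto_zero.2 h).sub hS0
    simpa using this
  obtain hι | hι := isEmpty_or_nonempty ι
  · have : ∀ k, x k + S k = 0 := fun k => Subsingleton.elim _ _
    simp [this]
  obtain ⟨i₀, hi₀⟩ := Finite.exists_min d
  obtain ⟨i₁, hi₁⟩ := Finite.exists_max d
  -- The slowest coordinate, with speed `d i₀`, fixes the contraction rate; the fastest, `d i₁`,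
  -- bounds the perturbation.
  refine tendsto_zero_of_recursion (ε := ε) (e := fun k => (1 + γ) * ‖S k‖ + e k)
    (c := (1 - γ) * d i₀) (C := d i₁)
    (mul_pos (by linarith) (hd i₀)) (fun k => norm_nonneg _) hε0 hε hε1 ?_ ?_
  · simpa using (hS0.norm.const_mul (1 + γ)).add he
  have h2 : ∀ᶠ K in atTop, ∀ i, ε K * d i ≤ 1 := by
    rw [eventually_all]
    intro i
    have := hε.mul_const (d i)
    rw [zero_mul] at this
    exact (this.eventually (gt_mem_nhds one_pos)).mono fun _ h => h.le
  filter_upwards [h2] with k hk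
  set z := x k + S k with hz
  have hS' : ∀ i, |S k i| ≤ ‖S k‖ := norm_le_pi_norm (S k)
  have hz' : ∀ i, |z i| ≤ ‖z‖ := norm_le_pi_norm z
  have hxk : ‖x k‖ ≤ ‖z‖ + ‖S k‖ := by
    have : x k = z - S k := by simp [hz]
    rw [this]; exact norm_sub_le _ _
  have main : ∀ i, |(x (k + 1) + S (k + 1)) i| ≤
      (1 - (1 - γ) * d i₀ * ε k) * ‖z‖ + d i₁ * ε k * ((1 + γ) * ‖S k‖ + e k) := by
    intro i
    have e1 : (x (k + 1) + S (k + 1)) i = (1 - ε k * d i) * z i + ε k * d i * (F k i + S k i) := by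
      simp only [hz, Pi.add_apply, hSs, hrec]; ring
    have hεd := mul_nonneg (hε0 k) (hd i).le
    have e2 : |F k i + S k i| ≤ γ * ‖z‖ + ((1 + γ) * ‖S k‖ + e k) := by
      have := abs_add_le (F k i) (S k i)
      have := hF k i
      have := hS' i
      have := mul_le_mul_of_nonneg_left hxk hγ0
      linarith
    rw [e1]
    refine (abs_add_le _ _).trans ?_
    rw [abs_mul, abs_mul, abs_of_nonneg (by linarith [hk i] : 0 ≤ 1 - ε k * d i),
      abs_of_nonneg hεd]
    have e3 := mul_le_mul_of_nonneg_left (hz' i) (by linarith [hk i] : 0 ≤ 1 - ε k * d i)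
    have e4 := mul_le_mul_of_nonneg_left e2 hεd
    have e5 : ε k * d i₀ * ((1 - γ) * ‖z‖) ≤ ε k * d i * ((1 - γ) * ‖z‖) :=
      mul_le_mul_of_nonneg_right (mul_le_mul_of_nonneg_left (hi₀ i) (hε0 k))
        (mul_nonneg (by linarith) (norm_nonneg _))
    have e6 : ε k * d i * ((1 + γ) * ‖S k‖ + e k) ≤ ε k * d i₁ * ((1 + γ) * ‖S k‖ + e k) :=
      mul_le_mul_of_nonneg_right (mul_le_mul_of_nonneg_left (hi₁ i) (hε0 k))
        (add_nonneg (mul_nonneg (by linarith) (norm_nonneg _)) (he0 k))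
    linarith
  refine (pi_norm_le_iff_of_nonempty _).2 main

end Deterministic

/-! ### Almost sure convergence of the weighted noise -/

section Noise

variable {E S Ω : Type*} [MeasurableSpace E] [MeasurableSpace S] [mΩ : MeasurableSpace Ω]

/-- The filtration whose `k`-th σ-algebra is generated by `w 0, …, w (k - 1)`. -/
def pastFiltration (w : ℕ → Ω → E) (hw : ∀ k, Measurable (w k)) : Filtration ℕ mΩ where
  seq k := ⨆ j ∈ Set.Iio k, MeasurableSpace.comap (w j) inferInstance
  mono' _ _ hij := biSup_mono fun _ h => lt_of_lt_of_le h hij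
  le' _ := iSup₂_le fun j _ => (hw j).comap_le

lemma measurable_pastFiltration {w : ℕ → Ω → E} (hw : ∀ k, Measurable (w k)) {j k : ℕ}
    (hjk : j < k) : Measurable[pastFiltration w hw k] (w j) :=
  Measurable.mono (comap_measurable (w j))
    (le_iSup₂_of_le (f := fun j (_ : j ∈ Set.Iio k) => MeasurableSpace.comap (w j) inferInstance)
      j hjk le_rfl) le_rfl

variable {Pr : Measure Ω}

/-- The index sets `{0, …, k - 1}` and `{k}` are disjoint. The strict inequality in the past
σ-algebra is what makes the current state independent of the sample that updates it. -/
lemma indepFun_of_measurable_past {w : ℕ → Ω → E} (hw : ∀ k, Measurable (w k))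
    (hind : iIndepFun w Pr) {k : ℕ} {Y : Ω → S} (hY : Measurable[pastFiltration w hw k] Y) :
    IndepFun Y (w k) Pr := by
  have h := indep_iSup_of_disjoint (fun j => (hw j).comap_le) hind
    (S := Set.Iio k) (T := {k}) (by simp)
  rw [iSup_singleton] at h
  rw [IndepFun_iff_Indep]
  exact indep_of_indep_of_le_left h hY.comap_le

/-- Under independence the joint law is a product, and Fubini integrates the sample out first. This
takes the place of a conditional expectation. -/
lemma integral_eq_zero_of_indepFun [IsProbabilityMeasure Pr] {Y : Ω → S} {W : Ω → E} (hY : Measurable Y) (hW : Measurable W)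
    (hind : IndepFun Y W Pr) {g : S → E → ℝ} (hg : Measurable (Function.uncurry g))
    (hg0 : ∀ s, ∫ τ, g s τ ∂(Pr.map W) = 0) (hint : Integrable (fun ω => g (Y ω) (W ω)) Pr) :
    ∫ ω, g (Y ω) (W ω) ∂Pr = 0 := by
  have hmap := (indepFun_iff_map_prod_eq_prod_map_map hY.aemeasurable hW.aemeasurable).1 hind
  have : IsProbabilityMeasure (Pr.map Y) := Measure.isProbabilityMeasure_map hY.aemeasurable
  have : IsProbabilityMeasure (Pr.map W) := Measure.isProbabilityMeasure_map hW.aemeasurable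
  have h1 : ∫ ω, g (Y ω) (W ω) ∂Pr = ∫ p, Function.uncurry g p ∂(Pr.map Y).prod (Pr.map W) := by
    rw [← hmap, integral_map (hY.prodMk hW).aemeasurable hg.aestronglyMeasurable]
    rfl
  have h2 : Integrable (Function.uncurry g) ((Pr.map Y).prod (Pr.map W)) := by
    rw [← hmap]
    exact (integrable_map_measure hg.aestronglyMeasurable (hY.prodMk hW).aemeasurable).2 hint
  rw [h1, integral_prod _ h2]
  simp [Function.uncurry, hg0]

/-- The noise of a stochastic-approximation scheme driven by an i.i.d. sequence is almost surely
summable, when it has uniformly bounded conditional second moments and the stepsizes are square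
summable. -/
lemma ae_exists_tendsto_noise [IsProbabilityMeasure Pr] {w : ℕ → Ω → E} (hw : ∀ k, Measurable (w k))
    (hind : iIndepFun w Pr) {P : Measure E} (hlaw : ∀ k, Pr.map (w k) = P)
    {s : ℕ → Ω → S} (hs : ∀ k, Measurable[pastFiltration w hw k] (s k))
    {g : S → E → ℝ} (hg : Measurable (Function.uncurry g)) {b : E → ℝ} (hbm : Measurable b)
    (hb : ∀ s, ∀ᵐ τ ∂P, |g s τ| ≤ b τ) (hb2 : MemLp b 2 P)
    {ε : ℕ → ℝ} (hε : Summable fun k => ε k ^ 2) :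
    ∀ᵐ ω ∂Pr, ∃ L, Tendsto (fun n => ∑ k ∈ Finset.range n,
      ε k * (g (s k ω) (w k ω) - ∫ τ, g (s k ω) τ ∂P)) atTop (𝓝 L) := by
  have hP : IsProbabilityMeasure P := by
    rw [← hlaw 0]; exact Measure.isProbabilityMeasure_map (hw 0).aemeasurable
  have hbint : Integrable b P := hb2.integrable (by norm_num)
  have hgs : ∀ x, Measurable (g x) := fun x => hg.comp measurable_prodMk_left
  have hgint : ∀ x, Integrable (g x) P := fun x =>
    hbint.mono' (hgs x).aestronglyMeasurable (hb x)
  have hmm : Measurable fun x => ∫ τ, g x τ ∂P :=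
    (hg.stronglyMeasurable.integral_prod_right (ν := P)).measurable
  set h : S → E → ℝ := fun x τ => g x τ - ∫ τ, g x τ ∂P with hh
  have hhm : Measurable (Function.uncurry h) := hg.sub (hmm.comp measurable_fst)
  have hh0 : ∀ x, ∫ τ, h x τ ∂P = 0 := fun x => by
    simp only [hh]
    rw [integral_sub (hgint x) (integrable_const _)]; simp
  set b' : E → ℝ := fun τ => b τ + ∫ τ, b τ ∂P with hb'
  have hb'm : Measurable b' := hbm.add_const _
  have hb'2 : MemLp b' 2 P := hb2.add (memLp_const _)
  have hhb : ∀ x, ∀ᵐ τ ∂P, |h x τ| ≤ b' τ := fun x => by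
    have h1 : |∫ τ, g x τ ∂P| ≤ ∫ τ, b τ ∂P :=
      norm_integral_le_of_norm_le (f := g x) hbint (hb x)
    filter_upwards [hb x] with τ hτ
    exact (abs_sub _ _).trans (add_le_add hτ h1)
  have hsm : ∀ k, Measurable (s k) := fun k => (hs k).mono ((pastFiltration w hw).le k) le_rfl
  -- The null set in `hhb` depends on the state; Fubini on the product law shows that the random
  -- state does not hit it.
  have hae : ∀ k, ∀ᵐ ω ∂Pr, |h (s k ω) (w k ω)| ≤ b' (w k ω) := by
    intro k
    have hmap := (indepFun_iff_map_prod_eq_prod_map_map (hsm k).aemeasurable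
      (hw k).aemeasurable).1 (indepFun_of_measurable_past hw hind (hs k))
    have hms : MeasurableSet {p : S × E | |Function.uncurry h p| ≤ b' p.2} :=
      measurableSet_le hhm.abs (hb'm.comp measurable_snd)
    have h1 : ∀ᵐ p ∂(Pr.map (s k)).prod P, |Function.uncurry h p| ≤ b' p.2 :=
      (Measure.ae_prod_iff_ae_ae hms).2 (ae_of_all _ fun x => hhb x)
    rw [hlaw k] at hmap
    rw [← hmap] at h1
    exact (ae_map_iff ((hsm k).prodMk (hw k)).aemeasurable hms).1 h1
  set ξ : ℕ → Ω → ℝ := fun k ω => ε k * h (s k ω) (w k ω) with hξ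
  have hhsm : ∀ k, Measurable fun ω => h (s k ω) (w k ω) := fun k =>
    hhm.comp ((hsm k).prodMk (hw k))
  have hbw : ∀ k, MemLp (fun ω => b' (w k ω)) 2 Pr := fun k =>
    (by rw [hlaw k]; exact hb'2 : MemLp b' 2 (Pr.map (w k))).comp_of_map (hw k).aemeasurable
  have hh2 : ∀ k, MemLp (fun ω => h (s k ω) (w k ω)) 2 Pr := fun k =>
    (hbw k).mono (hhsm k).aestronglyMeasurable ((hae k).mono fun ω hω => by
      rw [Real.norm_eq_abs, Real.norm_eq_abs]; exact hω.trans (le_abs_self _))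
  have hξ2 : ∀ k, MemLp (ξ k) 2 Pr := fun k => (hh2 k).const_mul (ε k)
  set A : ℕ → Ω → ℝ := fun n ω => ∑ k ∈ Finset.range n, ξ k ω with hA
  have hA2 : ∀ n, MemLp (A n) 2 Pr := fun n => memLp_finsetSum _ fun k _ => hξ2 k
  have hAs : ∀ n ω, A (n + 1) ω = A n ω + ξ n ω := fun n ω => Finset.sum_range_succ _ _
  have hAm : ∀ n, Measurable[pastFiltration w hw n] (A n) := fun n => by
    refine Finset.measurable_fun_sum _ fun k hk => ?_
    have hk' := Finset.mem_range.1 hk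
    have h1 : Measurable[pastFiltration w hw n] (s k) :=
      (hs k).mono ((pastFiltration w hw).mono hk'.le) le_rfl
    exact Measurable.const_mul (hhm.comp (h1.prodMk (measurable_pastFiltration hw hk'))) (ε k)
  -- Used twice: indicators for `Z` give the martingale property, and `Z = A n` removes the cross
  -- term in the second moment.
  have horth : ∀ n, ∀ Z : Ω → ℝ, Measurable[pastFiltration w hw n] Z →
      Integrable (fun ω => Z ω * h (s n ω) (w n ω)) Pr →
      ∫ ω, Z ω * h (s n ω) (w n ω) ∂Pr = 0 := by
    intro n Z hZ hint
    have hZs : Measurable[pastFiltration w hw n] fun ω => (Z ω, s n ω) := hZ.prodMk (hs n)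
    refine integral_eq_zero_of_indepFun (Y := fun ω => (Z ω, s n ω)) (W := w n)
      (g := fun p τ => p.1 * h p.2 τ)
      (hZs.mono ((pastFiltration w hw).le n) le_rfl) (hw n)
      (indepFun_of_measurable_past hw hind hZs) ?_ ?_ hint
    · exact (measurable_fst.comp measurable_fst).mul
        (hhm.comp ((measurable_snd.comp measurable_fst).prodMk measurable_snd))
    · intro p
      rw [hlaw n, integral_const_mul, hh0, mul_zero]
  have hmart : Martingale A (pastFiltration w hw) Pr := by
    refine martingale_of_setIntegral_eq_succ (fun n => (hAm n).stronglyMeasurable)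
      (fun n => (hA2 n).integrable (by norm_num)) fun n t ht => ?_
    have e1 : ∫ ω in t, ξ n ω ∂Pr = 0 := by
      have ht' : MeasurableSet t := (pastFiltration w hw).le n t ht
      have e2 : ∀ ω, t.indicator (ξ n) ω =
          ε n * (t.indicator (fun _ => (1 : ℝ)) ω * h (s n ω) (w n ω)) := fun ω => by
        by_cases hω : ω ∈ t <;> simp [hω, hξ]
      rw [← integral_indicator ht']
      simp_rw [e2]
      rw [integral_const_mul, horth n _ (measurable_const.indicator ht), mul_zero]
      have := ((hh2 n).integrable (by norm_num : (1 : ℝ≥0∞) ≤ 2)).indicator ht'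
      refine this.congr (ae_of_all _ fun ω => ?_)
      by_cases hω : ω ∈ t <;> simp [hω]
    simp_rw [hAs]
    rw [integral_add ((hA2 n).integrable (by norm_num)).integrableOn
      ((hξ2 n).integrable (by norm_num)).integrableOn, e1, add_zero]
  set V := ∫ τ, b' τ ^ 2 ∂P with hV
  have hV0 : 0 ≤ V := integral_nonneg fun τ => sq_nonneg _
  have hξV : ∀ k, ∫ ω, ξ k ω ^ 2 ∂Pr ≤ ε k ^ 2 * V := by
    intro k
    have e1 : V = ∫ ω, b' (w k ω) ^ 2 ∂Pr := by
      rw [hV, ← hlaw k, integral_map (hw k).aemeasurable (hb'm.pow_const 2).aestronglyMeasurable]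
    rw [e1, ← integral_const_mul]
    refine integral_mono_ae (hξ2 k).integrable_sq ((hbw k).integrable_sq.const_mul _) ?_
    filter_upwards [hae k] with ω hω
    simp only [hξ, mul_pow]
    exact mul_le_mul_of_nonneg_left (sq_le_sq.2 (hω.trans (le_abs_self _))) (sq_nonneg _)
  have hAV : ∀ n, ∫ ω, A n ω ^ 2 ∂Pr ≤ V * ∑ k ∈ Finset.range n, ε k ^ 2 := by
    intro n
    induction n with
    | zero => simp [hA]
    | succ n ih =>
      have hprod : Integrable (fun ω => A n ω * ξ n ω) Pr := (hA2 n).integrable_mul (hξ2 n)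
      have e0 : ∫ ω, A n ω * ξ n ω ∂Pr = 0 := by
        have e2 : ∀ ω, A n ω * ξ n ω = ε n * (A n ω * h (s n ω) (w n ω)) := fun ω => by
          simp only [hξ]; ring
        simp_rw [e2]
        rw [integral_const_mul, horth n _ (hAm n) ((hA2 n).integrable_mul (hh2 n)), mul_zero]
      have e1 : ∀ ω, A (n + 1) ω ^ 2 = A n ω ^ 2 + (2 * (A n ω * ξ n ω) + ξ n ω ^ 2) :=
        fun ω => by rw [hAs]; ring
      simp_rw [e1]
      have e3 : Integrable (fun ω => 2 * (A n ω * ξ n ω) + ξ n ω ^ 2) Pr :=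
        (hprod.const_mul 2).add (hξ2 n).integrable_sq
      rw [integral_add (hA2 n).integrable_sq e3,
        integral_add (hprod.const_mul 2) (hξ2 n).integrable_sq, integral_const_mul, e0,
        Finset.sum_range_succ]
      have := hξV n
      linarith
  set R : ℝ := 1 + V * ∑' k, ε k ^ 2 with hR
  have hbdd : ∀ n, eLpNorm (A n) 1 Pr ≤ (R.toNNReal : ℝ≥0∞) := by
    intro n
    have hAi : Integrable (A n) Pr := (hA2 n).integrable (by norm_num)
    rw [eLpNorm_one_eq_lintegral_enorm, ← ofReal_integral_norm_eq_lintegral_enorm hAi]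
    refine ENNReal.ofReal_le_ofReal ?_
    have e1 : ∫ ω, ‖A n ω‖ ∂Pr ≤ ∫ ω, (1 + A n ω ^ 2) ∂Pr := by
      refine integral_mono hAi.norm ((integrable_const _).add (hA2 n).integrable_sq) fun ω => ?_
      simp only [Real.norm_eq_abs]
      rw [← sq_abs]
      nlinarith [sq_nonneg (|A n ω| - 1), abs_nonneg (A n ω)]
    rw [integral_add (integrable_const _) (hA2 n).integrable_sq] at e1
    have e2 := hAV n
    have e3 := mul_le_mul_of_nonneg_left
      (hε.sum_le_tsum (Finset.range n) fun k _ => sq_nonneg (ε k)) hV0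
    simp only [integral_const, probReal_univ, smul_eq_mul, one_mul] at e1
    linarith
  exact hmart.submartingale.exists_ae_tendsto_of_bdd hbdd

end Noise

/-! ### One-step transitions and the Markov property of trajectories -/

section OneStep

variable {X A : Type*} [Fintype X] [Fintype A] [MeasurableSpace X] [MeasurableSpace A]
  [MeasurableSingletonClass X] [MeasurableSingletonClass A]

/-- The expected value of `f` at the next state-action pair. -/
def pairMean (M : EpisodicMDP X A) (μ : Policy X A) (f : X × A → ℝ) (z : X × A) : ℝ :=
  ∫ z', f z' ∂pairKernel M μ z

omit [Fintype X] [Fintype A] [MeasurableSpace X] [MeasurableSpace A] [MeasurableSingletonClass X]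
  [MeasurableSingletonClass A] in
lemma nextPair_apply (M : EpisodicMDP X A) (μ : Policy X A) (z z' : X × A) :
    nextPair M μ z z' = M.P z.1 z.2 z'.1 * μ z'.1 z'.2 := by
  classical
  rw [nextPair, PMF.bind_apply, tsum_eq_single z'.1]
  · congr 1
    rw [PMF.map_apply, tsum_eq_single z'.2]
    · simp
    · intro a ha
      exact if_neg fun h => ha (congrArg Prod.snd h).symm
  · intro x hx
    rw [PMF.map_apply]
    simp only [mul_eq_zero, ENNReal.tsum_eq_zero]
    right
    intro a
    exact if_neg fun h => hx (congrArg Prod.fst h).symm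

lemma pairMean_eq_sum (M : EpisodicMDP X A) (μ : Policy X A) (f : X × A → ℝ) (z : X × A) :
    pairMean M μ f z =
      ∑ z' : X × A, (M.P z.1 z.2 z'.1).toReal * (μ z'.1 z'.2).toReal * f z' := by
  have : pairMean M μ f z = ∫ z', f z' ∂(nextPair M μ z).toMeasure := rfl
  rw [this, PMF.integral_eq_sum]
  simp [nextPair_apply, ENNReal.toReal_mul]

/-- The mean reward. -/
def meanReward (M : EpisodicMDP X A) (z : X × A) : ℝ := ∫ r, r ∂(M.reward z.1 z.2 : Measure ℝ)

lemma emitKernel_apply (M : EpisodicMDP X A) (z : X × A) :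
    emitKernel M z = (M.reward z.1 z.2 : Measure ℝ).map fun r => (z.1, z.2, r) := rfl

lemma ae_emitKernel (M : EpisodicMDP X A) {p : X × A × ℝ → Prop} (z : X × A)
    (h : ∀ᵐ r ∂(M.reward z.1 z.2 : Measure ℝ), p (z.1, z.2, r)) (hp : MeasurableSet {s | p s}) :
    ∀ᵐ s ∂emitKernel M z, p s := by
  rw [emitKernel_apply]
  exact (ae_map_iff (by fun_prop) hp).2 h

lemma integral_emitKernel (M : EpisodicMDP X A) (z : X × A) {g : X × A × ℝ → ℝ}
    (hg : Measurable g) :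
    ∫ s, g s ∂emitKernel M z = ∫ r, g (z.1, z.2, r) ∂(M.reward z.1 z.2 : Measure ℝ) := by
  rw [emitKernel_apply, integral_map (by fun_prop) hg.aestronglyMeasurable]

lemma integral_emitKernel_pair (M : EpisodicMDP X A) (z : X × A) (f : X × A → ℝ) :
    ∫ s, f (s.1, s.2.1) ∂emitKernel M z = f z := by
  have hf : Measurable fun s : X × A × ℝ => f (s.1, s.2.1) :=
    (measurable_of_finite f).comp (by fun_prop)
  rw [integral_emitKernel M z hf]
  simp

lemma integral_emitKernel_reward (M : EpisodicMDP X A) (z : X × A) (f : X × A → ℝ) :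
    ∫ s, f (s.1, s.2.1) * s.2.2 ∂emitKernel M z = f z * meanReward M z := by
  have hf : Measurable fun s : X × A × ℝ => f (s.1, s.2.1) * s.2.2 :=
    ((measurable_of_finite f).comp (by fun_prop)).mul (by fun_prop)
  rw [integral_emitKernel M z hf]
  exact integral_const_mul (f z) _

lemma stepKernel_apply (M : EpisodicMDP X A) (μ : Policy X A) (s : X × A × ℝ) :
    stepKernel M μ s = (emitKernel M ∘ₖ pairKernel M μ) (s.1, s.2.1) := rfl

lemma ae_stepKernel (M : EpisodicMDP X A) (μ : Policy X A) {p : X × A × ℝ → Prop}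
    (hp : MeasurableSet {s | p s}) (h : ∀ z, ∀ᵐ s ∂emitKernel M z, p s) (s : X × A × ℝ) :
    ∀ᵐ s' ∂stepKernel M μ s, p s' := by
  rw [stepKernel_apply]
  exact Kernel.ae_comp_of_ae_ae hp (ae_of_all _ h)

lemma integral_stepKernel (M : EpisodicMDP X A) (μ : Policy X A) {g : X × A × ℝ → ℝ} {C : ℝ}
    (hg : Measurable g) (hgC : ∀ z, ∀ᵐ s ∂emitKernel M z, |g s| ≤ C) (s : X × A × ℝ) :
    ∫ s', g s' ∂stepKernel M μ s =
      pairMean M μ (fun z => ∫ s', g s' ∂emitKernel M z) (s.1, s.2.1) := by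
  have h1 := ae_stepKernel M μ (measurableSet_le hg.abs measurable_const) hgC s
  have h2 : Integrable g (stepKernel M μ s) :=
    (integrable_const C).mono' hg.aestronglyMeasurable h1
  rw [stepKernel_apply] at h2 ⊢
  rw [Kernel.integral_comp h2]
  rfl

variable (M : EpisodicMDP X A) (μ : Policy X A) (ν : PMF (X × A))

instance : IsProbabilityMeasure (trajLaw M μ ν) := by
  unfold trajLaw; infer_instance

lemma trajLaw_map_zero : (trajLaw M μ ν).map (fun τ => τ 0) = emitKernel M ∘ₘ ν.toMeasure := by
  rw [trajLaw, Kernel.trajMeasure]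
  have h0 : (fun τ : Traj X A => τ 0) =
      (MeasurableEquiv.piUnique fun _ : Finset.Iic 0 => X × A × ℝ) ∘
        Preorder.frestrictLe (π := fun _ => X × A × ℝ) 0 := by
    ext τ <;> rfl
  rw [h0, ← Measure.map_map (by fun_prop) (by fun_prop), Measure.map_comp _ _ (by fun_prop),
    Kernel.traj_map_frestrictLe, Kernel.partialTraj_self, Measure.id_comp,
    Measure.map_map (by fun_prop) (by fun_prop), MeasurableEquiv.self_comp_symm, Measure.map_id]

omit [Fintype X] [Fintype A] [MeasurableSingletonClass X] [MeasurableSingletonClass A] in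
lemma measurable_coord (n : ℕ) : Measurable fun τ : Traj X A => τ n := measurable_pi_apply n

lemma trajLaw_map_succ (n : ℕ) :
    ((trajLaw M μ ν).map (Preorder.frestrictLe n)) ⊗ₘ
      ((stepKernel M μ).comap (fun h => h ⟨n, by simp⟩) (by fun_prop)) =
    (trajLaw M μ ν).map (fun τ => (Preorder.frestrictLe n τ, τ (n + 1))) :=
  Kernel.map_frestrictLe_trajMeasure_compProd_eq_map_trajMeasure
    (X := fun _ => X × A × ℝ) (a := n)

lemma ae_trajLaw_zero {p : X × A × ℝ → Prop} (hp : MeasurableSet {s | p s})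
    (h : ∀ z, ∀ᵐ s ∂emitKernel M z, p s) : ∀ᵐ τ ∂trajLaw M μ ν, p (τ 0) := by
  have h1 : ∀ᵐ s ∂(trajLaw M μ ν).map (fun τ => τ 0), p s := by
    rw [trajLaw_map_zero]
    exact Measure.ae_comp_of_ae_ae hp (ae_of_all _ h)
  exact (ae_map_iff (measurable_coord 0).aemeasurable hp).1 h1

lemma ae_trajLaw_succ {p : X × A × ℝ → X × A × ℝ → Prop}
    (hp : MeasurableSet {q : (X × A × ℝ) × (X × A × ℝ) | p q.1 q.2})
    (h : ∀ s, ∀ᵐ s' ∂stepKernel M μ s, p s s') (n : ℕ) :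
    ∀ᵐ τ ∂trajLaw M μ ν, p (τ n) (τ (n + 1)) := by
  have hp' : MeasurableSet {q : (Π _ : Finset.Iic n, X × A × ℝ) × (X × A × ℝ) |
      p (q.1 ⟨n, by simp⟩) q.2} :=
    (show Measurable fun q : (Π _ : Finset.Iic n, X × A × ℝ) × (X × A × ℝ) =>
      (q.1 ⟨n, by simp⟩, q.2) by fun_prop) hp
  have h1 : ∀ᵐ q ∂(trajLaw M μ ν).map (fun τ => (Preorder.frestrictLe n τ, τ (n + 1))),
      p (q.1 ⟨n, by simp⟩) q.2 := by
    rw [← trajLaw_map_succ]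
    exact Measure.ae_compProd_of_ae_ae hp' (ae_of_all _ fun a => h _)
  exact (ae_map_iff (by fun_prop) hp').1 h1

lemma ae_trajLaw {p : X × A × ℝ → Prop} (hp : MeasurableSet {s | p s})
    (h : ∀ z, ∀ᵐ s ∂emitKernel M z, p s) : ∀ᵐ τ ∂trajLaw M μ ν, ∀ n, p (τ n) := by
  rw [ae_all_iff]
  rintro (_ | n)
  · exact ae_trajLaw_zero M μ ν hp h
  · exact ae_trajLaw_succ M μ ν (p := fun _ s' => p s') (measurable_snd hp)
      (ae_stepKernel M μ hp h) n

lemma integral_trajLaw_zero {g : X × A × ℝ → ℝ} {C : ℝ}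
    (hg : Measurable g) (hgC : ∀ z, ∀ᵐ s ∂emitKernel M z, |g s| ≤ C) :
    ∫ τ, g (τ 0) ∂trajLaw M μ ν = ∑ z, (ν z).toReal * ∫ s, g s ∂emitKernel M z := by
  have h1 : ∫ τ, g (τ 0) ∂trajLaw M μ ν = ∫ s, g s ∂(emitKernel M ∘ₘ ν.toMeasure) := by
    rw [← trajLaw_map_zero M μ ν, integral_map (measurable_coord 0).aemeasurable hg.aestronglyMeasurable]
  have h2 : Integrable g (emitKernel M ∘ₘ ν.toMeasure) :=
    (integrable_const C).mono' hg.aestronglyMeasurable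
      (Measure.ae_comp_of_ae_ae (measurableSet_le hg.abs measurable_const) (ae_of_all _ hgC))
  rw [h1]
  rw [Measure.comp_eq_comp_const_apply] at h2 ⊢
  rw [Kernel.integral_comp h2, Kernel.const_apply, PMF.integral_eq_sum]
  rfl

/-- The Markov property: integrating out the next step. -/
lemma integral_trajLaw_succ {n : ℕ} {H : Traj X A → ℝ} {K : ℝ} (hHm : Measurable H)
    (hHK : ∀ τ, |H τ| ≤ K) (hH : ∀ τ : Traj X A, H (fun k => τ (min k n)) = H τ)
    {g : X × A × ℝ → ℝ} {C : ℝ}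
    (hg : Measurable g) (hgC : ∀ z, ∀ᵐ s ∂emitKernel M z, |g s| ≤ C) :
    ∫ τ, H τ * g (τ (n + 1)) ∂trajLaw M μ ν =
      ∫ τ, H τ * pairMean M μ (fun z => ∫ s', g s' ∂emitKernel M z) ((τ n).1, (τ n).2.1)
        ∂trajLaw M μ ν := by
  -- By `hH`, freezing the path at time `n` does not change `H`, so `H` factors through the first `n
  -- + 1` coordinates by way of this extension.
  set ext : (Π _ : Finset.Iic n, X × A × ℝ) → Traj X A := fun a k => a ⟨min k n, by simp⟩
  have hext : Measurable ext := by fun_prop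
  have hHe : ∀ τ : Traj X A, H (ext (Preorder.frestrictLe n τ)) = H τ := fun τ => hH τ
  set F : (Π _ : Finset.Iic n, X × A × ℝ) × (X × A × ℝ) → ℝ := fun q => H (ext q.1) * g q.2
  have hF : Measurable F :=
    (hHm.comp (hext.comp measurable_fst)).mul (hg.comp measurable_snd)
  have e1 : ∫ τ, H τ * g (τ (n + 1)) ∂trajLaw M μ ν = ∫ q, F q ∂(trajLaw M μ ν).map
      (fun τ => (Preorder.frestrictLe n τ, τ (n + 1))) := by
    rw [integral_map (by fun_prop) hF.aestronglyMeasurable]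
    exact integral_congr_ae (ae_of_all _ fun τ => by simp only [F, hHe])
  have hK0 : 0 ≤ K := (abs_nonneg _).trans (hHK fun _ => (Classical.choice
    (⟨(ν.support_nonempty.some.1, ν.support_nonempty.some.2, 0)⟩ : Nonempty (X × A × ℝ))))
  have hFint : Integrable F (((trajLaw M μ ν).map (Preorder.frestrictLe n)) ⊗ₘ
      ((stepKernel M μ).comap (fun h => h ⟨n, by simp⟩) (by fun_prop))) := by
    have : IsProbabilityMeasure ((trajLaw M μ ν).map
        (Preorder.frestrictLe (π := fun _ => X × A × ℝ) n)) :=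
      Measure.isProbabilityMeasure_map (by fun_prop)
    refine (integrable_const (K * C)).mono' hF.aestronglyMeasurable ?_
    refine Measure.ae_compProd_of_ae_ae (measurableSet_le hF.norm measurable_const)
      (ae_of_all _ fun a => ?_)
    refine (ae_stepKernel M μ (measurableSet_le hg.abs measurable_const) hgC _).mono fun s hs => ?_
    simp only [F, norm_mul, Real.norm_eq_abs]
    exact mul_le_mul (hHK _) hs (abs_nonneg _) hK0
  rw [e1, ← trajLaw_map_succ, Measure.integral_compProd hFint, integral_map (by fun_prop)]
  · refine integral_congr_ae (ae_of_all _ fun τ => ?_)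
    simp only [F, Kernel.comap_apply, integral_const_mul, hHe]
    rw [integral_stepKernel M μ hg hgC]
    rfl
  · simp only [F, Kernel.comap_apply, integral_const_mul]
    refine ((hHm.comp hext).mul ?_).aestronglyMeasurable
    simp_rw [integral_stepKernel M μ hg hgC]
    exact (measurable_of_finite (pairMean M μ fun z => ∫ s', g s' ∂emitKernel M z)).comp
      (by fun_prop)

end OneStep

/-! ### Discounted series of bounded functions -/

lemma integral_tsum_discounted {E : Type*} [MeasurableSpace E] {P : Measure E}
    [IsProbabilityMeasure P] {γ C : ℝ} (hγ0 : 0 ≤ γ) (hγ1 : γ < 1) {F : ℕ → E → ℝ}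
    (hF : ∀ m, Measurable (F m)) (hFC : ∀ m, ∀ᵐ τ ∂P, |F m τ| ≤ C) :
    ∫ τ, ∑' m, γ ^ m * F m τ ∂P = ∑' m, γ ^ m * ∫ τ, F m τ ∂P := by
  have hint : ∀ m, Integrable (F m) P := fun m =>
    (integrable_const C).mono' (hF m).aestronglyMeasurable (hFC m)
  rw [← integral_tsum_of_summable_integral_norm (fun m => (hint m).const_mul (γ ^ m))]
  · simp_rw [integral_const_mul]
  · refine Summable.of_nonneg_of_le (fun m => integral_nonneg fun τ => norm_nonneg _) (fun m => ?_)
      ((summable_geometric_of_lt_one hγ0 hγ1).mul_right C)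
    simp_rw [norm_mul, integral_const_mul, norm_pow, Real.norm_of_nonneg hγ0]
    refine mul_le_mul_of_nonneg_left ?_ (pow_nonneg hγ0 m)
    have := integral_mono_ae (hint m).norm (integrable_const C) (hFC m)
    simpa using this

lemma abs_tsum_discounted_le {γ C : ℝ} (hγ0 : 0 ≤ γ) (hγ1 : γ < 1) {f : ℕ → ℝ}
    (hf : ∀ m, |f m| ≤ C) : |∑' m, γ ^ m * f m| ≤ C / (1 - γ) := by
  have h1 : HasSum (fun m => γ ^ m * C) ((1 - γ)⁻¹ * C) :=
    (hasSum_geometric_of_lt_one hγ0 hγ1).mul_right C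
  have := tsum_of_norm_bounded h1 (f := fun m => γ ^ m * f m) fun m => by
    rw [Real.norm_eq_abs, abs_mul, abs_of_nonneg (pow_nonneg hγ0 m)]
    exact mul_le_mul_of_nonneg_left (hf m) (pow_nonneg hγ0 m)
  rwa [Real.norm_eq_abs, mul_comm, ← div_eq_mul_inv] at this

lemma summable_discounted {γ C : ℝ} (hγ0 : 0 ≤ γ) (hγ1 : γ < 1) {f : ℕ → ℝ}
    (hf : ∀ m, |f m| ≤ C) : Summable fun m => γ ^ m * f m :=
  Summable.of_norm_bounded ((summable_geometric_of_lt_one hγ0 hγ1).mul_right C) fun m => by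
    rw [Real.norm_eq_abs, abs_mul, abs_of_nonneg (pow_nonneg hγ0 m)]
    exact mul_le_mul_of_nonneg_left (hf m) (pow_nonneg hγ0 m)

/-! ### Weighted means and products of weights along a trajectory -/

section Chains

variable {X A : Type*} [Fintype X] [Fintype A] [MeasurableSpace X] [MeasurableSpace A]
  [MeasurableSingletonClass X] [MeasurableSingletonClass A]

variable (M : EpisodicMDP X A) (μ : Policy X A) (ν : PMF (X × A))

lemma abs_pairMean_le {f : X × A → ℝ} {C : ℝ} (hf : ∀ z, |f z| ≤ C) (z : X × A) :
    |pairMean M μ f z| ≤ C := by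
  have := norm_integral_le_of_norm_le_const (f := f) (μ := pairKernel M μ z) (ae_of_all _ hf)
  simpa [pairMean] using this

/-- The expected value of `f` at the next state-action pair, weighted by `c`. -/
def weightedMean (c f : X × A → ℝ) : X × A → ℝ := pairMean M μ fun z => c z * f z

variable {c : X × A → ℝ}

lemma abs_iterate_weightedMean_le (hc : ∀ z, |c z| ≤ 1) {f : X × A → ℝ} {C : ℝ}
    (hf : ∀ z, |f z| ≤ C) (m : ℕ) (z : X × A) : |((weightedMean M μ c)^[m] f) z| ≤ C := by
  induction m generalizing z with
  | zero => exact hf z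
  | succ m ih =>
    rw [Function.iterate_succ_apply']
    refine abs_pairMean_le M μ (fun z => ?_) z
    rw [abs_mul]
    exact (mul_le_of_le_one_left (abs_nonneg _) (hc z)).trans (ih z)

omit [MeasurableSpace X] [MeasurableSpace A] [MeasurableSingletonClass X]
  [MeasurableSingletonClass A] in
lemma exists_abs_le (f : X × A → ℝ) : ∃ C, ∀ z, |f z| ≤ C :=
  ⟨‖f‖, fun z => norm_le_pi_norm f z⟩

/-- The discounted sum of the iterates of the weighted mean. -/
def discountedMean (c f : X × A → ℝ) (z : X × A) : ℝ :=
  ∑' m, M.γ ^ m * ((weightedMean M μ c)^[m] f) z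

/-- Splitting off the first term of the Neumann series gives its fixed-point equation. With `c = 1`
this becomes the Bellman equation, with truncated ratios the equation of the Retrace operator. -/
lemma discountedMean_eq (hc : ∀ z, |c z| ≤ 1) (f : X × A → ℝ) (z : X × A) :
    discountedMean M μ c f z =
      f z + M.γ * weightedMean M μ c (discountedMean M μ c f) z := by
  obtain ⟨C, hC⟩ := exists_abs_le f
  have hb := abs_iterate_weightedMean_le M μ hc hC
  rw [discountedMean, (summable_discounted M.γ_nonneg M.γ_lt_one fun m => hb m z).tsum_eq_zero_add]
  simp only [pow_zero, Function.iterate_zero, id_eq, one_mul, add_right_inj]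
  have h1 : weightedMean M μ c (discountedMean M μ c f) z =
      ∑' m, M.γ ^ m * ((weightedMean M μ c)^[m + 1] f) z := by
    have e1 : ∀ z', c z' * discountedMean M μ c f z' =
        ∑' m, M.γ ^ m * (c z' * ((weightedMean M μ c)^[m] f) z') := fun z' => by
      rw [discountedMean, ← tsum_mul_left]
      exact tsum_congr fun m => by ring
    rw [weightedMean, pairMean]
    simp_rw [e1]
    rw [integral_tsum_discounted M.γ_nonneg M.γ_lt_one (C := C)
      (fun m => measurable_of_finite _) (fun m => ae_of_all _ fun z' => ?_)]
    · simp_rw [Function.iterate_succ_apply']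
      rfl
    · rw [abs_mul]
      exact (mul_le_of_le_one_left (abs_nonneg _) (hc z')).trans (hb m z')
  rw [h1, ← tsum_mul_left]
  exact tsum_congr fun m => by rw [pow_succ']; ring

omit [Fintype X] [Fintype A] [MeasurableSpace X] [MeasurableSpace A] [MeasurableSingletonClass X]
  [MeasurableSingletonClass A] in
lemma abs_prod_le_one (hc : ∀ z, |c z| ≤ 1) (s : Finset ℕ) (τ : Traj X A) :
    |∏ u ∈ s, c ((τ u).1, (τ u).2.1)| ≤ 1 := by
  rw [Finset.abs_prod]
  exact Finset.prod_le_one (fun _ _ => abs_nonneg _) fun _ _ => hc _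

lemma measurable_pair_comp (f : X × A → ℝ) (n : ℕ) :
    Measurable fun τ : Traj X A => f ((τ n).1, (τ n).2.1) :=
  (measurable_of_finite f).comp (by fun_prop)

lemma measurable_chain (c : X × A → ℝ) (s : Finset ℕ) :
    Measurable fun τ : Traj X A => ∏ u ∈ s, c ((τ u).1, (τ u).2.1) :=
  Finset.measurable_fun_prod s fun u _ => measurable_pair_comp c u

lemma integral_trajLaw_succ_pair {n : ℕ} {H : Traj X A → ℝ} {K : ℝ} (hHm : Measurable H)
    (hHK : ∀ τ, |H τ| ≤ K) (hH : ∀ τ : Traj X A, H (fun k => τ (min k n)) = H τ)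
    (f : X × A → ℝ) :
    ∫ τ, H τ * f ((τ (n + 1)).1, (τ (n + 1)).2.1) ∂trajLaw M μ ν =
      ∫ τ, H τ * pairMean M μ f ((τ n).1, (τ n).2.1) ∂trajLaw M μ ν := by
  obtain ⟨C, hC⟩ := exists_abs_le f
  rw [integral_trajLaw_succ M μ ν hHm hHK hH (g := fun s => f (s.1, s.2.1)) (C := C)
    ((measurable_of_finite f).comp (by fun_prop)) (fun z => ae_of_all _ fun s => hC _)]
  simp_rw [integral_emitKernel_pair]

/-- Integrating out the weights along the trajectory. -/
lemma integral_chain (hc : ∀ z, |c z| ≤ 1) {n : ℕ} {H : Traj X A → ℝ} {K : ℝ} (hHm : Measurable H)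
    (hHK : ∀ τ, |H τ| ≤ K) (hH : ∀ τ : Traj X A, H (fun k => τ (min k n)) = H τ)
    (f : X × A → ℝ) (m : ℕ) :
    ∫ τ, H τ * (∏ u ∈ Finset.Ioc n (n + m), c ((τ u).1, (τ u).2.1)) *
        f ((τ (n + m)).1, (τ (n + m)).2.1) ∂trajLaw M μ ν =
      ∫ τ, H τ * ((weightedMean M μ c)^[m] f) ((τ n).1, (τ n).2.1) ∂trajLaw M μ ν := by
  induction m generalizing f with
  | zero => simp
  | succ m ih =>
    have h1 := integral_trajLaw_succ_pair M μ ν (n := n + m) (K := K)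
      (H := fun τ => H τ * ∏ u ∈ Finset.Ioc n (n + m), c ((τ u).1, (τ u).2.1))
      (hHm.mul (measurable_chain c _))
      (fun τ => by
        rw [abs_mul]
        exact (mul_le_of_le_one_right (abs_nonneg _) (abs_prod_le_one hc _ τ)).trans (hHK τ))
      (fun τ => by
        congr 1
        · rw [← hH τ, ← hH]
          congr 1
          ext k : 1
          rw [show min (min k n) (n + m) = min k n by omega]
        · refine Finset.prod_congr rfl fun u hu => ?_
          simp only [min_eq_left (Finset.mem_Ioc.1 hu).2])
      (fun z => c z * f z)
    -- The Markov step integrates out the last time, so the innermost operator is the one peeled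
    -- off, and the induction hypothesis is used at the new function `weightedMean M μ c f`.
    rw [Function.iterate_succ_apply, ← ih]
    refine Eq.trans ?_ h1
    refine integral_congr_ae (ae_of_all _ fun τ => ?_)
    simp only [← add_assoc]
    rw [Finset.prod_Ioc_succ_top (by omega : n ≤ n + m)]
    ring

/-- The mean of the reward given the state-action pair. -/
lemma integral_chain_reward {B : ℝ} (hB : ∀ x a, ∀ᵐ r ∂(M.reward x a : Measure ℝ), |r| ≤ B)
    (hc : ∀ z, |c z| ≤ 1) (n : ℕ) (k : X × A → ℝ) (m : ℕ) :
    ∫ τ, k ((τ n).1, (τ n).2.1) * (∏ u ∈ Finset.Ioc n (n + m), c ((τ u).1, (τ u).2.1)) *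
        (τ (n + m)).2.2 ∂trajLaw M μ ν =
      ∫ τ, k ((τ n).1, (τ n).2.1) * (∏ u ∈ Finset.Ioc n (n + m), c ((τ u).1, (τ u).2.1)) *
        meanReward M ((τ (n + m)).1, (τ (n + m)).2.1) ∂trajLaw M μ ν := by
  obtain ⟨K, hK⟩ := exists_abs_le k
  have hbd : ∀ (f : X × A → ℝ) (C : ℝ), (∀ z, |f z| ≤ C) → ∀ z, ∀ᵐ s ∂emitKernel M z,
      |f (s.1, s.2.1) * s.2.2| ≤ C * B := by
    intro f C hC z
    have hf : Measurable fun s : X × A × ℝ => f (s.1, s.2.1) * s.2.2 :=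
      ((measurable_of_finite f).comp (by fun_prop)).mul (by fun_prop)
    refine ae_emitKernel M z ?_ (measurableSet_le hf.abs measurable_const)
    filter_upwards [hB z.1 z.2] with r hr
    rw [abs_mul]
    exact mul_le_mul (hC _) hr (abs_nonneg _) ((abs_nonneg _).trans (hC z))
  have hm : ∀ f : X × A → ℝ, Measurable fun s : X × A × ℝ => f (s.1, s.2.1) * s.2.2 := fun f =>
    ((measurable_of_finite f).comp (by fun_prop)).mul (by fun_prop)
  have hstep : ∀ (j : ℕ) (H : Traj X A → ℝ) (K : ℝ), Measurable H → (∀ τ, |H τ| ≤ K) →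
      (∀ τ : Traj X A, H (fun k => τ (min k j)) = H τ) → ∀ f : X × A → ℝ,
      ∫ τ, H τ * (f ((τ (j + 1)).1, (τ (j + 1)).2.1) * (τ (j + 1)).2.2) ∂trajLaw M μ ν =
      ∫ τ, H τ * (f ((τ (j + 1)).1, (τ (j + 1)).2.1) *
        meanReward M ((τ (j + 1)).1, (τ (j + 1)).2.1)) ∂trajLaw M μ ν := by
    intro j H K hHm hHK hH f
    obtain ⟨C, hC⟩ := exists_abs_le f
    rw [integral_trajLaw_succ M μ ν hHm hHK hH (g := fun s => f (s.1, s.2.1) * s.2.2)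
      (hm f) (hbd f C hC),
      integral_trajLaw_succ_pair M μ ν hHm hHK hH (fun z => f z * meanReward M z)]
    simp_rw [integral_emitKernel_reward]
  cases m with
  | zero =>
    simp only [add_zero, Finset.Ioc_self, Finset.prod_empty, mul_one]
    -- At time `0` the pair comes from `ν` and not from a transition, so this case cannot go through
    -- `hstep`.
    cases n with
    | zero =>
      rw [integral_trajLaw_zero M μ ν (g := fun s => k (s.1, s.2.1) * s.2.2) (hm k) (hbd k K hK)]
      obtain ⟨C, hC⟩ := exists_abs_le fun z => k z * meanReward M z
      rw [integral_trajLaw_zero M μ ν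
        (g := fun s => k (s.1, s.2.1) * meanReward M (s.1, s.2.1)) (C := C)
        ((measurable_of_finite fun z => k z * meanReward M z).comp (by fun_prop))
        (fun z => ae_of_all _ fun s => hC _)]
      simp_rw [integral_emitKernel_reward]
      simp_rw [integral_emitKernel_pair M _ fun z => k z * meanReward M z]
    | succ n =>
      have := hstep n (fun _ => 1) 1 measurable_const (by simp) (fun _ => rfl) k
      simpa using this
  | succ m =>
    have h1 := hstep (n + m)
      (fun τ => k ((τ n).1, (τ n).2.1) * ∏ u ∈ Finset.Ioc n (n + m), c ((τ u).1, (τ u).2.1)) K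
      ((measurable_pair_comp k n).mul (measurable_chain c _))
      (fun τ => by
        rw [abs_mul]
        exact (mul_le_of_le_one_right (abs_nonneg _) (abs_prod_le_one hc _ τ)).trans (hK _))
      (fun τ => by
        congr 1
        · simp only [min_eq_left (Nat.le_add_right n m)]
        · refine Finset.prod_congr rfl fun u hu => ?_
          simp only [min_eq_left (Finset.mem_Ioc.1 hu).2]) c
    simp only [← add_assoc, Finset.prod_Ioc_succ_top (by omega : n ≤ n + m)]
    refine Eq.trans (integral_congr_ae (ae_of_all _ fun τ => ?_))
      (h1.trans (integral_congr_ae (ae_of_all _ fun τ => ?_)))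
    · simp only; ring
    · simp only; ring

end Chains

/-! ### Policies and truncated importance weights -/

lemma sum_toReal_eq_one {A : Type*} [Fintype A] (p : PMF A) : ∑ a, (p a).toReal = 1 := by
  rw [← ENNReal.toReal_sum fun a _ => p.apply_ne_top a, ← tsum_fintype (L := .unconditional A),
    p.tsum_coe, ENNReal.toReal_one]

section Weights

variable {X A : Type*}

lemma truncWeight_nonneg (π μ : Policy X A) (x : X) (a : A) : 0 ≤ truncWeight π μ x a :=
  le_min zero_le_one (div_nonneg ENNReal.toReal_nonneg ENNReal.toReal_nonneg)

lemma truncWeight_le_one (π μ : Policy X A) (x : X) (a : A) : truncWeight π μ x a ≤ 1 :=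
  min_le_left _ _

lemma abs_truncWeight_le_one (π μ : Policy X A) (x : X) (a : A) : |truncWeight π μ x a| ≤ 1 := by
  rw [abs_of_nonneg (truncWeight_nonneg π μ x a)]
  exact truncWeight_le_one π μ x a

/-- The source of the contraction: it makes the one-step mean under `π` minus the weighted mean
under `μ` a nonnegative kernel. Where `μ` vanishes, the value given to the quotient is irrelevant.
-/
lemma mul_truncWeight_le (π μ : Policy X A) (x : X) (a : A) :
    (μ x a).toReal * truncWeight π μ x a ≤ (π x a).toReal := by
  obtain h | h := (ENNReal.toReal_nonneg (a := μ x a)).eq_or_lt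
  · rw [← h, zero_mul]; exact ENNReal.toReal_nonneg
  · refine (mul_le_mul_of_nonneg_left (min_le_right _ _) h.le).trans ?_
    rw [mul_div_cancel₀ _ h.ne']

lemma abs_sum_policy_le [Fintype A] (π : Policy X A) (x : X) {f : A → ℝ} {C : ℝ}
    (hf : ∀ a, |f a| ≤ C) : |∑ a, (π x a).toReal * f a| ≤ C := by
  calc |∑ a, (π x a).toReal * f a| ≤ ∑ a, |(π x a).toReal * f a| :=
        Finset.abs_sum_le_sum_abs _ _
    _ ≤ ∑ a, (π x a).toReal * C := Finset.sum_le_sum fun a _ => by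
        rw [abs_mul, abs_of_nonneg ENNReal.toReal_nonneg]
        exact mul_le_mul_of_nonneg_left (hf a) ENNReal.toReal_nonneg
    _ = C := by rw [← Finset.sum_mul, sum_toReal_eq_one, one_mul]

end Weights

/-! ### Trajectory lengths -/

section Length

variable {X A : Type*} (M : EpisodicMDP X A)

lemma notMem_terminal_of_lt_trajLength {τ : Traj X A} {t : ℕ}
    (h : (t : ℕ∞) < trajLength M τ) : (τ t).1 ∉ M.terminal := fun ht =>
  absurd h (not_lt.2 (iInf₂_le (f := fun (t : ℕ) (_ : (τ t).1 ∈ M.terminal) => (t : ℕ∞)) t ht))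

lemma trajLength_eq_coe_iff {τ : Traj X A} {n : ℕ} :
    trajLength M τ = n ↔ (τ n).1 ∈ M.terminal ∧ ∀ t < n, (τ t).1 ∉ M.terminal := by
  constructor
  · intro h
    have h2 : ∀ t < n, (τ t).1 ∉ M.terminal := fun t ht =>
      notMem_terminal_of_lt_trajLength M (by rw [h]; exact_mod_cast ht)
    refine ⟨?_, h2⟩
    have h3 : trajLength M τ < (n + 1 : ℕ) := by rw [h]; exact_mod_cast Nat.lt_succ_self n
    simp only [trajLength, iInf_lt_iff] at h3
    obtain ⟨t, ht, htn⟩ := h3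
    have htn' : t < n + 1 := by exact_mod_cast htn
    obtain rfl : t = n := by
      by_contra hne
      exact h2 t (by omega) ht
    exact ht
  · rintro ⟨h1, h2⟩
    refine le_antisymm (iInf₂_le n h1) (le_iInf₂ fun t ht => ?_)
    by_contra hlt
    exact h2 t (by exact_mod_cast not_le.1 hlt) ht

variable [MeasurableSpace X] [MeasurableSpace A] [MeasurableSingletonClass X] [Finite X]

lemma measurable_trajLength : Measurable (trajLength M : Traj X A → ℕ∞) := by
  have ht : MeasurableSet M.terminal := (Set.toFinite _).measurableSet
  have hc : ∀ t, MeasurableSet {τ : Traj X A | (τ t).1 ∈ M.terminal} := fun t =>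
    (show Measurable fun τ : Traj X A => (τ t).1 by fun_prop) ht
  rw [ENat.measurable_iff]
  intro n
  have : trajLength M ⁻¹' {(n : ℕ∞)} = {τ : Traj X A | (τ n).1 ∈ M.terminal} ∩
      ⋂ t ∈ Set.Iio n, {τ : Traj X A | (τ t).1 ∈ M.terminal}ᶜ := by
    ext τ
    simp [trajLength_eq_coe_iff]
  rw [this]
  exact (hc n).inter (MeasurableSet.biInter (Set.to_countable _) fun t _ => (hc t).compl)

lemma measurable_trajLength_toNat : Measurable fun τ : Traj X A => (trajLength M τ).toNat :=
  (Measurable.of_discrete (f := ENat.toNat)).comp (measurable_trajLength M)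

lemma ae_trajLength_ne_top {P : Measure (Traj X A)}
    (hT : ∫⁻ τ, ((trajLength M τ : ℕ∞) : ℝ≥0∞) ^ 2 ∂P < ∞) : ∀ᵐ τ ∂P, trajLength M τ ≠ ⊤ := by
  have hm : Measurable fun τ : Traj X A => ((trajLength M τ : ℕ∞) : ℝ≥0∞) ^ 2 :=
    ((Measurable.of_discrete (f := fun n : ℕ∞ => (n : ℝ≥0∞))).comp
      (measurable_trajLength M)).pow_const 2
  filter_upwards [ae_lt_top hm hT.ne] with τ hτ h
  simp [h] at hτ

lemma memLp_trajLength {P : Measure (Traj X A)}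
    (hT : ∫⁻ τ, ((trajLength M τ : ℕ∞) : ℝ≥0∞) ^ 2 ∂P < ∞) :
    MemLp (fun τ => ((trajLength M τ).toNat : ℝ)) 2 P := by
  have hm : Measurable fun τ : Traj X A => ((trajLength M τ).toNat : ℝ) :=
    measurable_from_top.comp (measurable_trajLength_toNat M)
  rw [memLp_two_iff_integrable_sq hm.aestronglyMeasurable]
  refine ⟨(hm.pow_const 2).aestronglyMeasurable, lt_of_le_of_lt (lintegral_mono fun τ => ?_) hT⟩
  have h1 : ‖((trajLength M τ).toNat : ℝ) ^ 2‖ₑ = (((trajLength M τ).toNat : ℕ) : ℝ≥0∞) ^ 2 := by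
    rw [enorm_pow]
    congr 1
    rw [Real.enorm_eq_ofReal (Nat.cast_nonneg _), ENNReal.ofReal_natCast]
  rw [h1]
  gcongr
  exact_mod_cast ENat.natCast_toNat_le_self (trajLength M τ)

end Length

/-! ### The mean of a Retrace increment -/

section Retrace

variable {X A : Type*} [Fintype X] [Fintype A] [MeasurableSpace X] [MeasurableSpace A]
  [MeasurableSingletonClass X] [MeasurableSingletonClass A]

variable (M : EpisodicMDP X A) (π μ : Policy X A) (ν : PMF (X × A))

lemma ae_absorbing : ∀ᵐ τ ∂trajLaw M μ ν, ∀ n,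
    (τ n).1 ∈ M.terminal → (τ (n + 1)).1 = (τ n).1 := by
  rw [ae_all_iff]
  intro n
  have hfin : ∀ s : Set (X × X), MeasurableSet s := fun s => (Set.toFinite s).measurableSet
  refine ae_trajLaw_succ M μ ν (p := fun s s' => s.1 ∈ M.terminal → s'.1 = s.1) ?_ ?_ n
  · exact (show Measurable fun q : (X × A × ℝ) × (X × A × ℝ) => (q.1.1, q.2.1) by fun_prop)
      (hfin {p | p.1 ∈ M.terminal → p.2 = p.1})
  · intro s
    by_cases hs : s.1 ∈ M.terminal
    swap
    · exact ae_of_all _ fun _ h => absurd h hs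
    rw [stepKernel_apply]
    have hms : ∀ x : X, MeasurableSet {s' : X × A × ℝ | s'.1 = x} := fun x =>
      measurable_fst (measurableSet_singleton x)
    refine (Kernel.ae_comp_of_ae_ae (p := fun s' : X × A × ℝ => s'.1 = s.1) (hms _) ?_).mono
      fun s' h _ => h
    have h1 : ∀ᵐ z ∂pairKernel M μ (s.1, s.2.1), z.1 = s.1 := by
      change ∀ᵐ z ∂(nextPair M μ (s.1, s.2.1)).toMeasure, z.1 = s.1
      rw [ae_iff, PMF.toMeasure_apply_eq_zero_iff _ (Set.toFinite _).measurableSet,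
        Set.disjoint_left]
      intro z hz hne
      rw [PMF.mem_support_iff, nextPair_apply, M.P_terminal _ hs] at hz
      refine hz ?_
      rw [PMF.pure_apply, if_neg hne, zero_mul]
    filter_upwards [h1] with z hz
    exact ae_emitKernel M z (ae_of_all _ fun r => hz) (hms _)

lemma ae_reward_terminal : ∀ᵐ τ ∂trajLaw M μ ν, ∀ n, (τ n).1 ∈ M.terminal → (τ n).2.2 = 0 := by
  have hmt : MeasurableSet M.terminal := (Set.toFinite _).measurableSet
  have hm : MeasurableSet {s : X × A × ℝ | s.1 ∈ M.terminal → s.2.2 = 0} := by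
    have : {s : X × A × ℝ | s.1 ∈ M.terminal → s.2.2 = 0} =
        (Prod.fst ⁻¹' M.terminal)ᶜ ∪ (fun s => s.2.2) ⁻¹' {0} := by
      ext s
      simp [imp_iff_not_or]
    rw [this]
    exact (measurable_fst hmt).compl.union
      ((show Measurable fun s : X × A × ℝ => s.2.2 by fun_prop) (measurableSet_singleton 0))
  refine ae_trajLaw M μ ν hm fun z => ae_emitKernel M z ?_ hm
  by_cases hz : z.1 ∈ M.terminal
  · rw [M.reward_terminal _ hz]
    simp
  · exact ae_of_all _ fun r h => absurd h hz

lemma ae_reward_bound {B : ℝ} (hB : ∀ x a, ∀ᵐ r ∂(M.reward x a : Measure ℝ), |r| ≤ B) :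
    ∀ᵐ τ ∂trajLaw M μ ν, ∀ n, |(τ n).2.2| ≤ B := by
  have hm : MeasurableSet {s : X × A × ℝ | |s.2.2| ≤ B} :=
    measurableSet_le (by fun_prop) measurable_const
  exact ae_trajLaw M μ ν hm fun z => ae_emitKernel M z (hB _ _) hm

omit [Fintype X] [MeasurableSpace X] [MeasurableSpace A]
  [MeasurableSingletonClass X] [MeasurableSingletonClass A] in
lemma abs_tdError_le {Q : X → A → ℝ} {q B : ℝ} (hq : ∀ x a, |Q x a| ≤ q) {τ : Traj X A}
    (hτ : ∀ n, |(τ n).2.2| ≤ B) (n : ℕ) : |tdError M π Q τ n| ≤ B + 2 * q := by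
  have h1 := hτ n
  have h2 := hq (τ n).1 (τ n).2.1
  have h3 : |M.γ * ∑ a, (π (τ (n + 1)).1 a).toReal * Q (τ (n + 1)).1 a| ≤ q := by
    rw [abs_mul, abs_of_nonneg M.γ_nonneg]
    exact (mul_le_of_le_one_left (abs_nonneg _) M.γ_lt_one.le).trans
      (abs_sum_policy_le π _ fun a => hq _ a)
  rw [tdError]
  have := abs_sub ((τ n).2.2 + M.γ * ∑ a, (π (τ (n + 1)).1 a).toReal * Q (τ (n + 1)).1 a)
    (Q (τ n).1 (τ n).2.1)
  have := abs_add_le (τ n).2.2 (M.γ * ∑ a, (π (τ (n + 1)).1 a).toReal * Q (τ (n + 1)).1 a)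
  linarith

lemma measurable_tdError (Q : X → A → ℝ) (n : ℕ) :
    Measurable fun τ : Traj X A => tdError M π Q τ n := by
  have h1 : Measurable fun τ : Traj X A => ∑ a, (π (τ (n + 1)).1 a).toReal * Q (τ (n + 1)).1 a :=
    (measurable_of_finite fun x => ∑ a, (π x a).toReal * Q x a).comp
      (show Measurable fun τ : Traj X A => (τ (n + 1)).1 by fun_prop)
  have h2 := measurable_pair_comp (fun z : X × A => Q z.1 z.2) n
  exact ((show Measurable fun τ : Traj X A => (τ n).2.2 by fun_prop).add (h1.const_mul _)).sub h2

/-- The integrand depends on the next state only, so the action drawn from `μ` sums out. This is why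
off-policy data gives the Bellman residual of the target policy. -/
lemma pairMean_policy_sum (Q : X → A → ℝ) :
    pairMean M μ (fun z => ∑ a, (π z.1 a).toReal * Q z.1 a) =
      pairMean M π fun z => Q z.1 z.2 := by
  ext z
  rw [pairMean_eq_sum, pairMean_eq_sum, Fintype.sum_prod_type, Fintype.sum_prod_type]
  refine Finset.sum_congr rfl fun x _ => ?_
  simp only [mul_assoc]
  rw [← Finset.mul_sum, ← Finset.mul_sum, ← Finset.sum_mul, sum_toReal_eq_one, one_mul]

/-- The Bellman residual of `Q`. -/
def bellmanResidual (Q : X → A → ℝ) (z : X × A) : ℝ :=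
  meanReward M z + M.γ * pairMean M π (fun z => Q z.1 z.2) z - Q z.1 z.2

variable {c : X × A → ℝ}

/-- The weight in front depends only on pairs up to time `n + m`, so the Markov property averages
the next-state value, while the reward is replaced by its mean given the current pair. -/
lemma integral_chain_tdError {B : ℝ} (hB : ∀ x a, ∀ᵐ r ∂(M.reward x a : Measure ℝ), |r| ≤ B)
    (hc : ∀ z, |c z| ≤ 1) (Q : X → A → ℝ) (n : ℕ) (k : X × A → ℝ) (m : ℕ) :
    ∫ τ, k ((τ n).1, (τ n).2.1) * (∏ u ∈ Finset.Ioc n (n + m), c ((τ u).1, (τ u).2.1)) *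
        tdError M π Q τ (n + m) ∂trajLaw M μ ν =
      ∫ τ, k ((τ n).1, (τ n).2.1) * (∏ u ∈ Finset.Ioc n (n + m), c ((τ u).1, (τ u).2.1)) *
        bellmanResidual M π Q ((τ (n + m)).1, (τ (n + m)).2.1) ∂trajLaw M μ ν := by
  obtain ⟨K, hK⟩ := exists_abs_le k
  set H : Traj X A → ℝ := fun τ =>
    k ((τ n).1, (τ n).2.1) * (∏ u ∈ Finset.Ioc n (n + m), c ((τ u).1, (τ u).2.1)) with hHdef
  have hHm : Measurable H := (measurable_pair_comp k n).mul (measurable_chain c _)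
  have hHK : ∀ τ, |H τ| ≤ K := fun τ => by
    rw [hHdef, abs_mul]
    exact (mul_le_of_le_one_right (abs_nonneg _) (abs_prod_le_one hc _ τ)).trans (hK _)
  have hHn : ∀ τ : Traj X A, H (fun k => τ (min k (n + m))) = H τ := fun τ => by
    simp only [hHdef]
    congr 1
    · simp only [min_eq_left (Nat.le_add_right n m)]
    · refine Finset.prod_congr rfl fun u hu => ?_
      simp only [min_eq_left (Finset.mem_Ioc.1 hu).2]
  have hint : ∀ (g : Traj X A → ℝ) (C : ℝ), Measurable g → (∀ᵐ τ ∂trajLaw M μ ν, |g τ| ≤ C) →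
      Integrable (fun τ => H τ * g τ) (trajLaw M μ ν) := fun g C hg hgC =>
    (integrable_const (K * C)).mono' (hHm.mul hg).aestronglyMeasurable (hgC.mono fun τ hτ => by
      rw [Real.norm_eq_abs, abs_mul]
      exact mul_le_mul (hHK τ) hτ (abs_nonneg _) ((abs_nonneg _).trans (hHK τ)))
  have hintf : ∀ (f : X × A → ℝ) (j : ℕ),
      Integrable (fun τ => H τ * f ((τ j).1, (τ j).2.1)) (trajLaw M μ ν) := fun f j => by
    obtain ⟨C, hC⟩ := exists_abs_le f
    exact hint (fun τ => f ((τ j).1, (τ j).2.1)) C (measurable_pair_comp f j)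
      (ae_of_all _ fun τ => hC _)
  set V : X × A → ℝ := fun z => ∑ a, (π z.1 a).toReal * Q z.1 a with hV
  have i1 : Integrable (fun τ => H τ * (τ (n + m)).2.2) (trajLaw M μ ν) :=
    hint _ B (by fun_prop) ((ae_reward_bound M μ ν hB).mono fun τ h => h _)
  have i2 := hintf V (n + m + 1)
  have i3 := hintf (fun z => Q z.1 z.2) (n + m)
  have i4 := hintf (meanReward M) (n + m)
  have i5 := hintf (pairMean M π fun z => Q z.1 z.2) (n + m)
  have e1 := integral_chain_reward M μ ν hB hc n k m
  have e2 := integral_trajLaw_succ_pair M μ ν hHm hHK hHn V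
  rw [hV, pairMean_policy_sum] at e2
  have l : ∀ τ, H τ * tdError M π Q τ (n + m) = H τ * (τ (n + m)).2.2 +
      M.γ * (H τ * V ((τ (n + m + 1)).1, (τ (n + m + 1)).2.1)) -
        H τ * Q (τ (n + m)).1 (τ (n + m)).2.1 := fun τ => by
    simp only [tdError, hV]; ring
  have r : ∀ τ, H τ * bellmanResidual M π Q ((τ (n + m)).1, (τ (n + m)).2.1) =
      H τ * meanReward M ((τ (n + m)).1, (τ (n + m)).2.1) +
      M.γ * (H τ * (pairMean M π fun z => Q z.1 z.2) ((τ (n + m)).1, (τ (n + m)).2.1)) -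
        H τ * Q (τ (n + m)).1 (τ (n + m)).2.1 := fun τ => by
    simp only [bellmanResidual]; ring
  change ∫ τ, H τ * tdError M π Q τ (n + m) ∂trajLaw M μ ν =
    ∫ τ, H τ * bellmanResidual M π Q ((τ (n + m)).1, (τ (n + m)).2.1) ∂trajLaw M μ ν
  change ∫ τ, H τ * (τ (n + m)).2.2 ∂trajLaw M μ ν =
    ∫ τ, H τ * meanReward M ((τ (n + m)).1, (τ (n + m)).2.1) ∂trajLaw M μ ν at e1
  simp_rw [l, r]
  have i12 : Integrable (fun τ => H τ * (τ (n + m)).2.2 +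
      M.γ * (H τ * V ((τ (n + m + 1)).1, (τ (n + m + 1)).2.1))) (trajLaw M μ ν) :=
    i1.add (i2.const_mul _)
  have i45 : Integrable (fun τ => H τ * meanReward M ((τ (n + m)).1, (τ (n + m)).2.1) +
      M.γ * (H τ * (pairMean M π fun z => Q z.1 z.2) ((τ (n + m)).1, (τ (n + m)).2.1)))
      (trajLaw M μ ν) := i4.add (i5.const_mul _)
  rw [integral_sub i12 i3, integral_sub i45 i3, integral_add i1 (i2.const_mul _),
    integral_add i4 (i5.const_mul _), integral_const_mul, integral_const_mul, e1, e2]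

/-- The Retrace increment at time `n` along an infinite trajectory. -/
def retraceSum (Q : X → A → ℝ) (n : ℕ) (τ : Traj X A) : ℝ :=
  ∑' m, M.γ ^ m * ((∏ u ∈ Finset.Ioc n (n + m), truncWeight π μ (τ u).1 (τ u).2.1) *
    tdError M π Q τ (n + m))

omit [Fintype X] [MeasurableSpace X] [MeasurableSpace A]
  [MeasurableSingletonClass X] [MeasurableSingletonClass A] in
lemma abs_truncProd_tdError_le {Q : X → A → ℝ} {q B : ℝ} (hq : ∀ x a, |Q x a| ≤ q)
    {τ : Traj X A} (hτ : ∀ n, |(τ n).2.2| ≤ B) (s : Finset ℕ) (n : ℕ) :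
    |(∏ u ∈ s, truncWeight π μ (τ u).1 (τ u).2.1) * tdError M π Q τ n| ≤ B + 2 * q := by
  rw [abs_mul]
  exact (mul_le_of_le_one_left (abs_nonneg _)
    (abs_prod_le_one (c := fun z => truncWeight π μ z.1 z.2)
      (fun z => abs_truncWeight_le_one π μ z.1 z.2) s τ)).trans (abs_tdError_le M π hq hτ n)

omit [Fintype X] [MeasurableSpace X] [MeasurableSpace A]
  [MeasurableSingletonClass X] [MeasurableSingletonClass A] in
lemma abs_retraceSum_le {Q : X → A → ℝ} {q B : ℝ} (hq : ∀ x a, |Q x a| ≤ q)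
    {τ : Traj X A} (hτ : ∀ n, |(τ n).2.2| ≤ B) (n : ℕ) :
    |retraceSum M π μ Q n τ| ≤ (B + 2 * q) / (1 - M.γ) :=
  abs_tsum_discounted_le M.γ_nonneg M.γ_lt_one fun _ =>
    abs_truncProd_tdError_le M π μ hq hτ _ _

/-- Term by term, the temporal difference error becomes the Bellman residual and then the product of
ratios is integrated out. The test function `k` plays the role of conditioning on the pair at time
`n`. -/
lemma integral_retraceSum {B : ℝ} (hB : ∀ x a, ∀ᵐ r ∂(M.reward x a : Measure ℝ), |r| ≤ B)
    (Q : X → A → ℝ) (n : ℕ) (k : X × A → ℝ) :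
    ∫ τ, k ((τ n).1, (τ n).2.1) * retraceSum M π μ Q n τ ∂trajLaw M μ ν =
      ∫ τ, k ((τ n).1, (τ n).2.1) * discountedMean M μ (fun z => truncWeight π μ z.1 z.2)
        (bellmanResidual M π Q) ((τ n).1, (τ n).2.1) ∂trajLaw M μ ν := by
  set c : X × A → ℝ := fun z => truncWeight π μ z.1 z.2
  have hc : ∀ z, |c z| ≤ 1 := fun z => abs_truncWeight_le_one π μ z.1 z.2
  obtain ⟨K, hK⟩ := exists_abs_le k
  obtain ⟨q, hq⟩ := exists_abs_le fun z : X × A => Q z.1 z.2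
  obtain ⟨D, hD⟩ := exists_abs_le (bellmanResidual M π Q)
  have hWD := abs_iterate_weightedMean_le M μ hc hD
  have e1 : ∀ τ : Traj X A, k ((τ n).1, (τ n).2.1) * retraceSum M π μ Q n τ =
      ∑' m, M.γ ^ m * (k ((τ n).1, (τ n).2.1) *
        (∏ u ∈ Finset.Ioc n (n + m), c ((τ u).1, (τ u).2.1)) * tdError M π Q τ (n + m)) := fun τ => by
    rw [retraceSum, ← tsum_mul_left]
    exact tsum_congr fun m => by simp only [c]; ring
  have e2 : ∀ τ : Traj X A, k ((τ n).1, (τ n).2.1) * discountedMean M μ c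
      (bellmanResidual M π Q) ((τ n).1, (τ n).2.1) =
      ∑' m, M.γ ^ m * (k ((τ n).1, (τ n).2.1) *
        ((weightedMean M μ c)^[m] (bellmanResidual M π Q)) ((τ n).1, (τ n).2.1)) := fun τ => by
    rw [discountedMean, ← tsum_mul_left]
    exact tsum_congr fun m => by ring
  simp_rw [e1, e2]
  rw [integral_tsum_discounted M.γ_nonneg M.γ_lt_one (C := K * (B + 2 * q)),
    integral_tsum_discounted M.γ_nonneg M.γ_lt_one (C := K * D)]
  · refine tsum_congr fun m => ?_
    rw [integral_chain_tdError M π μ ν hB hc Q n k m,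
      integral_chain M μ ν hc (H := fun τ => k ((τ n).1, (τ n).2.1)) (measurable_pair_comp k n)
        (fun τ => hK _) (fun τ => by simp only [min_self])]
  · exact fun m => (measurable_pair_comp k n).mul (measurable_pair_comp _ n)
  · refine fun m => ae_of_all _ fun τ => ?_
    rw [abs_mul]
    exact mul_le_mul (hK _) (hWD _ _) (abs_nonneg _) ((abs_nonneg _).trans (hK ((τ n).1, (τ n).2.1)))
  · exact fun m => ((measurable_pair_comp k n).mul (measurable_chain c _)).mul
      (measurable_tdError M π Q _)
  · refine fun m => (ae_reward_bound M μ ν hB).mono fun τ hτ => ?_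
    rw [mul_assoc, abs_mul]
    exact mul_le_mul (hK _) (abs_truncProd_tdError_le M π μ (fun x a => hq (x, a)) hτ _ _)
      (abs_nonneg _) ((abs_nonneg _).trans (hK ((τ n).1, (τ n).2.1)))

end Retrace

/-! ### The update collected from one trajectory -/

section UpdateSum

variable {X A : Type*} [Fintype A]

open Classical in
/-- The sum of the Retrace increments over the visits of a pair. -/
def updateSum (M : EpisodicMDP X A) (π μ : Policy X A) (Q : X → A → ℝ) (τ : Traj X A)
    (z : X × A) : ℝ :=
  ∑ t ∈ Finset.range (trajLength M τ).toNat,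
    if (τ t).1 = z.1 ∧ (τ t).2.1 = z.2 then retraceIncrement M π μ Q τ t else 0

variable (M : EpisodicMDP X A) (π μ : Policy X A)

lemma retraceUpdate_eq (ε : ℝ) (Q : X → A → ℝ) (τ : Traj X A) (x : X) (a : A) :
    retraceUpdate M π μ ε Q τ x a = Q x a + ε * updateSum M π μ Q τ (x, a) := rfl

lemma abs_retraceIncrement_le {Q : X → A → ℝ} {q B : ℝ} (hq : ∀ x a, |Q x a| ≤ q)
    {τ : Traj X A} (hτ : ∀ n, |(τ n).2.2| ≤ B) (t : ℕ) :
    |retraceIncrement M π μ Q τ t| ≤ (B + 2 * q) / (1 - M.γ) := by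
  have hD : 0 ≤ B + 2 * q := (abs_nonneg _).trans (abs_tdError_le M π hq hτ 0)
  rw [retraceIncrement, Finset.sum_Ico_eq_sum_range]
  refine (Finset.abs_sum_le_sum_abs _ _).trans ?_
  calc _ ≤ ∑ m ∈ Finset.range ((trajLength M τ).toNat - t), M.γ ^ m * (B + 2 * q) := by
        refine Finset.sum_le_sum fun m _ => ?_
        rw [mul_assoc, abs_mul, abs_of_nonneg (pow_nonneg M.γ_nonneg _), Nat.add_sub_cancel_left]
        exact mul_le_mul_of_nonneg_left (abs_truncProd_tdError_le M π μ hq hτ _ _)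
          (pow_nonneg M.γ_nonneg _)
    _ ≤ ∑' m, M.γ ^ m * (B + 2 * q) :=
        ((summable_geometric_of_lt_one M.γ_nonneg M.γ_lt_one).mul_right _).sum_le_tsum _
          fun m _ => mul_nonneg (pow_nonneg M.γ_nonneg _) hD
    _ = _ := by
        rw [tsum_mul_right, tsum_geometric_of_lt_one M.γ_nonneg M.γ_lt_one]
        ring

/-- At most one geometrically bounded increment per time step. The bound is affine in the size of
`Q`, which is what forces the normalization of the noise. -/
lemma abs_updateSum_le {Q : X → A → ℝ} {q B : ℝ} (hq : ∀ x a, |Q x a| ≤ q)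
    {τ : Traj X A} (hτ : ∀ n, |(τ n).2.2| ≤ B) (z : X × A) :
    |updateSum M π μ Q τ z| ≤ (trajLength M τ).toNat * ((B + 2 * q) / (1 - M.γ)) := by
  refine (Finset.abs_sum_le_sum_abs _ _).trans ?_
  refine (Finset.sum_le_card_nsmul _ _ ((B + 2 * q) / (1 - M.γ)) fun t _ => ?_).trans ?_
  · have h := abs_retraceIncrement_le M π μ hq hτ t
    split_ifs
    · exact h
    · rw [abs_zero]; exact (abs_nonneg _).trans h
  · simp

lemma updateSum_terminal (Q : X → A → ℝ) (τ : Traj X A) {z : X × A} (hz : z.1 ∈ M.terminal) :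
    updateSum M π μ Q τ z = 0 := by
  refine Finset.sum_eq_zero fun t ht => if_neg fun h => ?_
  refine notMem_terminal_of_lt_trajLength M (τ := τ) (t := t) ?_ (h.1 ▸ hz)
  exact (ENat.natCast_lt_natCast.2 (Finset.mem_range.1 ht)).trans_le (ENat.natCast_toNat_le_self _)

omit [Fintype A] in
lemma terminal_of_le_trajLength {τ : Traj X A} (hT : trajLength M τ ≠ ⊤)
    (habs : ∀ n, (τ n).1 ∈ M.terminal → (τ (n + 1)).1 = (τ n).1) {t : ℕ}
    (ht : (trajLength M τ).toNat ≤ t) : (τ t).1 ∈ M.terminal := by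
  induction t, ht using Nat.le_induction with
  | base => exact ((trajLength_eq_coe_iff M).1 (ENat.natCast_toNat hT).symm).1
  | succ t _ ih => rw [habs t ih]; exact ih

lemma tdError_terminal {Q : X → A → ℝ} (hQ : ∀ x ∈ M.terminal, ∀ a, Q x a = 0) {τ : Traj X A}
    (habs : ∀ n, (τ n).1 ∈ M.terminal → (τ (n + 1)).1 = (τ n).1)
    (hrew : ∀ n, (τ n).1 ∈ M.terminal → (τ n).2.2 = 0) {n : ℕ} (hn : (τ n).1 ∈ M.terminal) :
    tdError M π Q τ n = 0 := by
  rw [tdError, hrew n hn, habs n hn]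
  simp [hQ _ hn]

/-- After absorption the reward, both values of `Q` and hence the temporal difference error vanish,
so cutting the series at the trajectory length loses nothing. -/
lemma retraceIncrement_eq_retraceSum [Fintype X] {Q : X → A → ℝ}
    (hQ : ∀ x ∈ M.terminal, ∀ a, Q x a = 0) {τ : Traj X A} (hT : trajLength M τ ≠ ⊤)
    (habs : ∀ n, (τ n).1 ∈ M.terminal → (τ (n + 1)).1 = (τ n).1)
    (hrew : ∀ n, (τ n).1 ∈ M.terminal → (τ n).2.2 = 0) (t : ℕ) :
    retraceIncrement M π μ Q τ t = retraceSum M π μ Q t τ := by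
  rw [retraceIncrement, retraceSum, Finset.sum_Ico_eq_sum_range,
    tsum_eq_sum (s := Finset.range ((trajLength M τ).toNat - t))]
  · refine Finset.sum_congr rfl fun m _ => ?_
    rw [Nat.add_sub_cancel_left, mul_assoc]
  · intro m hm
    have hm' : (trajLength M τ).toNat ≤ t + m := by
      rw [Finset.mem_range] at hm; omega
    rw [tdError_terminal M π hQ habs hrew (terminal_of_le_trajLength M hT habs hm'), mul_zero,
      mul_zero]

end UpdateSum

/-! ### Expected updates, the Retrace contraction, and the value function -/

section Expected

variable {X A : Type*} [Fintype X] [Fintype A] [MeasurableSpace X] [MeasurableSpace A]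
  [MeasurableSingletonClass X] [MeasurableSingletonClass A]

variable (M : EpisodicMDP X A) (π μ : Policy X A) (ν : PMF (X × A))

open Classical in
/-- The indicator function of a state-action pair. -/
def pairIndicator (z z' : X × A) : ℝ := if z' = z then 1 else 0

omit [Fintype X] [Fintype A] [MeasurableSpace X] [MeasurableSpace A]
  [MeasurableSingletonClass X] [MeasurableSingletonClass A] in
lemma pairIndicator_nonneg (z z' : X × A) : 0 ≤ pairIndicator z z' := by
  unfold pairIndicator; split_ifs <;> norm_num

omit [Fintype X] [Fintype A] [MeasurableSpace X] [MeasurableSpace A]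
  [MeasurableSingletonClass X] [MeasurableSingletonClass A] in
lemma pairIndicator_le_one (z z' : X × A) : pairIndicator z z' ≤ 1 := by
  unfold pairIndicator; split_ifs <;> norm_num

/-- The expected number of visits of a pair. -/
def visits (z : X × A) : ℝ :=
  ∑' t, ∫ τ, pairIndicator z ((τ t).1, (τ t).2.1) ∂trajLaw M μ ν

lemma integrable_pairIndicator (z : X × A) (t : ℕ) :
    Integrable (fun τ => pairIndicator z ((τ t).1, (τ t).2.1)) (trajLaw M μ ν) :=
  (integrable_const (1 : ℝ)).mono' (measurable_pair_comp _ t).aestronglyMeasurable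
    (ae_of_all _ fun τ => by
      rw [Real.norm_of_nonneg (pairIndicator_nonneg _ _)]; exact pairIndicator_le_one _ _)

/-- A non-terminal pair can only be visited before absorption, so the number of visits is at most
the integrable trajectory length. -/
lemma summable_visits (hT : ∫⁻ τ, ((trajLength M τ : ℕ∞) : ℝ≥0∞) ^ 2 ∂(trajLaw M μ ν) < ∞)
    {z : X × A} (hz : z.1 ∉ M.terminal) :
    Summable fun t => ∫ τ, pairIndicator z ((τ t).1, (τ t).2.1) ∂trajLaw M μ ν := by
  refine summable_of_sum_range_le (c := ∫ τ, ((trajLength M τ).toNat : ℝ) ∂trajLaw M μ ν)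
    (fun t => integral_nonneg fun τ => pairIndicator_nonneg _ _) fun n => ?_
  rw [← integral_finsetSum _ fun t _ => integrable_pairIndicator M μ ν z t]
  refine integral_mono_ae (integrable_finsetSum _ fun t _ => integrable_pairIndicator M μ ν z t)
    ((memLp_trajLength M hT).integrable (by norm_num)) ?_
  filter_upwards [ae_trajLength_ne_top M hT, ae_absorbing M μ ν] with τ h1 h2
  calc ∑ t ∈ Finset.range n, pairIndicator z ((τ t).1, (τ t).2.1)
      ≤ ∑ t ∈ Finset.range n, if t < (trajLength M τ).toNat then (1 : ℝ) else 0 := by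
        refine Finset.sum_le_sum fun t _ => ?_
        split_ifs with h
        · exact pairIndicator_le_one _ _
        · refine (if_neg fun h' => hz ?_).le
          rw [← h']
          exact terminal_of_le_trajLength M h1 h2 (not_lt.1 h)
    _ ≤ _ := by
        rw [Finset.sum_boole]
        refine Nat.cast_le.2 ?_
        refine (Finset.card_le_card (t := Finset.range (trajLength M τ).toNat) fun t ht => ?_).trans
          (Finset.card_range _).le
        simpa using (Finset.mem_filter.1 ht).2

/-- Otherwise the visit at each single time has probability zero, and a countable union contradicts
coverage. -/
lemma visits_pos (hT : ∫⁻ τ, ((trajLength M τ : ℕ∞) : ℝ≥0∞) ^ 2 ∂(trajLaw M μ ν) < ∞)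
    {z : X × A} (hz : z.1 ∉ M.terminal)
    (hcov : 0 < trajLaw M μ ν {τ | ∃ t, (τ t).1 = z.1 ∧ (τ t).2.1 = z.2}) :
    0 < visits M μ ν z := by
  have h0 : ∀ t, 0 ≤ ∫ τ, pairIndicator z ((τ t).1, (τ t).2.1) ∂trajLaw M μ ν := fun t =>
    integral_nonneg fun τ => pairIndicator_nonneg _ _
  by_contra hneg
  have hs := summable_visits M μ ν hT hz
  have h1 : ∀ t, ∫ τ, pairIndicator z ((τ t).1, (τ t).2.1) ∂trajLaw M μ ν = 0 := fun t =>
    le_antisymm ((hs.le_tsum t fun j _ => h0 j).trans (not_lt.1 hneg)) (h0 t)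
  have h2 : ∀ᵐ τ ∂trajLaw M μ ν, ∀ t, pairIndicator z ((τ t).1, (τ t).2.1) = 0 :=
    ae_all_iff.2 fun t => (integral_eq_zero_iff_of_nonneg (fun τ => pairIndicator_nonneg _ _)
      (integrable_pairIndicator M μ ν z t)).1 (h1 t)
  refine hcov.ne' (measure_mono_null ?_ (ae_iff.1 h2))
  rintro τ ⟨t, ht1, ht2⟩ h
  have := h t
  rw [pairIndicator, if_pos (Prod.ext ht1 ht2)] at this
  exact one_ne_zero this

lemma measurable_retraceSum (Q : X → A → ℝ) (n : ℕ) :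
    Measurable (retraceSum M π μ Q n) :=
  Measurable.tsum fun _ => Measurable.const_mul
    ((measurable_chain (fun z => truncWeight π μ z.1 z.2) _).mul (measurable_tdError M π Q _)) _

/-- The expected Retrace update of a pair, summed over its visits. -/
lemma integral_updateSum {B : ℝ} (hB : ∀ x a, ∀ᵐ r ∂(M.reward x a : Measure ℝ), |r| ≤ B)
    (hT : ∫⁻ τ, ((trajLength M τ : ℕ∞) : ℝ≥0∞) ^ 2 ∂(trajLaw M μ ν) < ∞)
    {Q : X → A → ℝ} (hQ : ∀ x ∈ M.terminal, ∀ a, Q x a = 0) {z : X × A} (hz : z.1 ∉ M.terminal) :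
    ∫ τ, updateSum M π μ Q τ z ∂trajLaw M μ ν =
      visits M μ ν z * discountedMean M μ (fun z => truncWeight π μ z.1 z.2)
        (bellmanResidual M π Q) z := by
  obtain ⟨q, hq'⟩ := exists_abs_le fun z : X × A => Q z.1 z.2
  have hq : ∀ x a, |Q x a| ≤ q := fun x a => hq' (x, a)
  set F : ℕ → Traj X A → ℝ := fun t τ =>
    pairIndicator z ((τ t).1, (τ t).2.1) * retraceSum M π μ Q t τ with hF
  have hFm : ∀ t, Measurable (F t) := fun t =>
    (measurable_pair_comp _ t).mul (measurable_retraceSum M π μ Q t)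
  have hFb : ∀ t, ∀ᵐ τ ∂trajLaw M μ ν,
      ‖F t τ‖ ≤ pairIndicator z ((τ t).1, (τ t).2.1) * ((B + 2 * q) / (1 - M.γ)) := fun t =>
    (ae_reward_bound M μ ν hB).mono fun τ hτ => by
      rw [hF, norm_mul, Real.norm_of_nonneg (pairIndicator_nonneg _ _)]
      exact mul_le_mul_of_nonneg_left (abs_retraceSum_le M π μ hq hτ t) (pairIndicator_nonneg _ _)
  have hFi : ∀ t, Integrable (F t) (trajLaw M μ ν) := fun t =>
    ((integrable_pairIndicator M μ ν z t).mul_const _).mono' (hFm t).aestronglyMeasurable (hFb t)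
  -- The random cutoff is removed before integrating: past absorption the indicator of a
  -- non-terminal pair is zero.
  have h1 : ∀ᵐ τ ∂trajLaw M μ ν, updateSum M π μ Q τ z = ∑' t, F t τ := by
    filter_upwards [ae_trajLength_ne_top M hT, ae_absorbing M μ ν, ae_reward_terminal M μ ν]
      with τ g1 g2 g3
    rw [tsum_eq_sum (s := Finset.range (trajLength M τ).toNat)]
    · refine Finset.sum_congr rfl fun t _ => ?_
      rw [retraceIncrement_eq_retraceSum M π μ hQ g1 g2 g3]
      simp only [hF, pairIndicator, ite_mul, one_mul, zero_mul]
      by_cases h : ((τ t).1, (τ t).2.1) = z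
      · rw [if_pos h, if_pos ⟨congrArg Prod.fst h, congrArg Prod.snd h⟩]
      · rw [if_neg h, if_neg fun h' => h (Prod.ext h'.1 h'.2)]
    · intro t ht
      have ht' := terminal_of_le_trajLength M g1 g2 (not_lt.1 fun h => ht (Finset.mem_range.2 h))
      simp only [hF]
      rw [pairIndicator, if_neg fun h => hz ?_, zero_mul]
      rw [← h]; exact ht'
  rw [integral_congr_ae h1, ← integral_tsum_of_summable_integral_norm hFi, visits, ← tsum_mul_right]
  · refine tsum_congr fun t => ?_
    rw [integral_retraceSum M π μ ν hB Q t (pairIndicator z), ← integral_mul_const]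
    refine integral_congr_ae (ae_of_all _ fun τ => ?_)
    simp only [pairIndicator]
    split_ifs with h
    · rw [h]
    · simp
  · refine Summable.of_nonneg_of_le (fun t => integral_nonneg fun τ => norm_nonneg _) (fun t => ?_)
      ((summable_visits M μ ν hT hz).mul_right ((B + 2 * q) / (1 - M.γ)))
    rw [← integral_mul_const]
    exact integral_mono_ae (hFi t).norm ((integrable_pairIndicator M μ ν z t).mul_const _) (hFb t)

/-- The sup-norm contraction property of the Retrace operator. -/
lemma abs_retrace_contraction {c x e G : X × A → ℝ} (hc0 : ∀ z, 0 ≤ c z) (hc1 : ∀ z, c z ≤ 1)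
    (hcπ : ∀ z : X × A, (μ z.1 z.2).toReal * c z ≤ (π z.1 z.2).toReal) {ξ η : ℝ}
    (hx : ∀ z, |x z| ≤ ξ) (he : ∀ z, |e z| ≤ η)
    (hG : ∀ z, G z = M.γ * pairMean M π x z - x z + e z + M.γ * weightedMean M μ c G z)
    (z : X × A) : |G z + x z| ≤ M.γ * ξ + η / (1 - M.γ) := by
  have hγ0 := M.γ_nonneg
  have hγ1 : 0 < 1 - M.γ := sub_pos.2 M.γ_lt_one
  set y : X × A → ℝ := fun z => G z + x z with hy
  set w : X × A → ℝ := weightedMean M μ c fun _ => 1 with hw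
  have hp : ∀ z z' : X × A, 0 ≤ (M.P z.1 z.2 z'.1).toReal * (μ z'.1 z'.2).toReal := fun z z' => by positivity
  have hp1 : ∀ (pol : Policy X A) (z : X × A),
      ∑ z' : X × A, (M.P z.1 z.2 z'.1).toReal * (pol z'.1 z'.2).toReal = 1 := fun pol z => by
    have := pairMean_eq_sum M pol (fun _ => 1) z
    simpa [pairMean] using this.symm
  have hws : ∀ z, w z =
      ∑ z' : X × A, (M.P z.1 z.2 z'.1).toReal * (μ z'.1 z'.2).toReal * c z' := fun z => by
    rw [hw, weightedMean, pairMean_eq_sum]; simp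
  have hw0 : ∀ z, 0 ≤ w z := fun z => by
    rw [hws]; exact Finset.sum_nonneg fun z' _ => mul_nonneg (hp _ _) (hc0 _)
  have hw1 : ∀ z, w z ≤ 1 := fun z => by
    rw [hws, ← hp1 μ z]
    exact Finset.sum_le_sum fun z' _ => mul_le_of_le_one_right (hp _ _) (hc1 _)
  -- By `hcπ` the difference is a nonnegative kernel, and its total mass is `1 - w z`.
  have b1 : ∀ z, |pairMean M π x z - weightedMean M μ c x z| ≤ (1 - w z) * ξ := fun z => by
    have e1 : pairMean M π x z - weightedMean M μ c x z = ∑ z' : X × A, (M.P z.1 z.2 z'.1).toReal *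
        ((π z'.1 z'.2).toReal - (μ z'.1 z'.2).toReal * c z') * x z' := by
      rw [weightedMean, pairMean_eq_sum, pairMean_eq_sum, ← Finset.sum_sub_distrib]
      exact Finset.sum_congr rfl fun z' _ => by ring
    have e2 : 1 - w z = ∑ z' : X × A, (M.P z.1 z.2 z'.1).toReal *
        ((π z'.1 z'.2).toReal - (μ z'.1 z'.2).toReal * c z') := by
      rw [hws, ← hp1 π z, ← Finset.sum_sub_distrib]
      exact Finset.sum_congr rfl fun z' _ => by ring
    rw [e1, e2, Finset.sum_mul]
    refine (Finset.abs_sum_le_sum_abs _ _).trans (Finset.sum_le_sum fun z' _ => ?_)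
    have h0 := mul_nonneg (ENNReal.toReal_nonneg (a := M.P z.1 z.2 z'.1))
      (sub_nonneg.2 (hcπ z'))
    rw [abs_mul, abs_of_nonneg h0]
    exact mul_le_mul_of_nonneg_left (hx z') h0
  have : Nonempty (X × A) := ⟨z⟩
  obtain ⟨z₀, hz₀⟩ := Finite.exists_max fun z => |y z|
  set Y := |y z₀| with hY
  have b2 : |weightedMean M μ c y z₀| ≤ w z₀ * Y := by
    rw [hws, weightedMean, pairMean_eq_sum, Finset.sum_mul]
    refine (Finset.abs_sum_le_sum_abs _ _).trans (Finset.sum_le_sum fun z' _ => ?_)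
    have h0 := mul_nonneg (hp z₀ z') (hc0 z')
    rw [← mul_assoc, abs_mul, abs_of_nonneg h0]
    exact mul_le_mul_of_nonneg_left (hz₀ z') h0
  have hadd : weightedMean M μ c y z₀ = weightedMean M μ c G z₀ + weightedMean M μ c x z₀ := by
    simp only [weightedMean, pairMean_eq_sum, hy, ← Finset.sum_add_distrib]
    exact Finset.sum_congr rfl fun z' _ => by ring
  -- Rewriting the equation for `G` in terms of `y = G + x` cancels the bare `x`; it is evaluated
  -- where `|y|` is largest, so that `Y` also bounds `y` on the right.
  have hyz : y z₀ = M.γ * (pairMean M π x z₀ - weightedMean M μ c x z₀) +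
      M.γ * weightedMean M μ c y z₀ + e z₀ := by
    rw [hadd]
    simp only [hy]
    rw [hG z₀]
    ring
  have hYle : Y ≤ M.γ * ((1 - w z₀) * ξ) + M.γ * (w z₀ * Y) + η := by
    rw [hY, hyz]
    refine (abs_add_le _ _).trans (add_le_add ((abs_add_le _ _).trans (add_le_add ?_ ?_)) (he z₀))
    · rw [abs_mul, abs_of_nonneg hγ0]; exact mul_le_mul_of_nonneg_left (b1 z₀) hγ0
    · rw [abs_mul, abs_of_nonneg hγ0, ← hyz]; exact mul_le_mul_of_nonneg_left b2 hγ0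
  refine (hz₀ z).trans ?_
  have hξ : 0 ≤ ξ := (abs_nonneg _).trans (hx z)
  have hη : 0 ≤ η := (abs_nonneg _).trans (he z)
  set η' := η / (1 - M.γ) with hη'
  have hη1 : η = (1 - M.γ) * η' := by rw [hη']; field_simp
  have hη0 : 0 ≤ η' := div_nonneg hη hγ1.le
  have k1 : M.γ * w z₀ ≤ M.γ := mul_le_of_le_one_right hγ0 (hw1 z₀)
  have k2 : 0 < 1 - M.γ * w z₀ := by linarith
  -- It suffices that `1 - w z₀ ≤ 1 - γ * w z₀` and `1 - γ ≤ 1 - γ * w z₀`, both from `0 ≤ w z₀ ≤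
  -- 1`.
  have k3 : (1 - M.γ * w z₀) * Y ≤ (1 - M.γ * w z₀) * (M.γ * ξ + η') := by
    have k4 : M.γ * (1 - w z₀) * ξ ≤ (1 - M.γ * w z₀) * (M.γ * ξ) := by
      have : M.γ * ξ * (M.γ * w z₀) ≤ M.γ * ξ * w z₀ :=
        mul_le_mul_of_nonneg_left (mul_le_of_le_one_left (hw0 z₀) M.γ_lt_one.le)
          (mul_nonneg hγ0 hξ)
      linarith
    have k5 : (1 - M.γ) * η' ≤ (1 - M.γ * w z₀) * η' :=
      mul_le_mul_of_nonneg_right (by linarith) hη0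
    linarith
  exact le_of_mul_le_mul_left k3 k2

/-- `Q^π` as a discounted sum. -/
lemma qValue_eq_discountedMean {B : ℝ}
    (hB : ∀ x a, ∀ᵐ r ∂(M.reward x a : Measure ℝ), |r| ≤ B) (x : X) (a : A) :
    qValue M π x a = discountedMean M π (fun _ => 1) (meanReward M) (x, a) := by
  rw [qValue, integral_tsum_discounted M.γ_nonneg M.γ_lt_one (F := fun t τ => (τ t).2.2) (C := B)
    (fun t => by fun_prop) (fun t => (ae_reward_bound M π _ hB).mono fun τ h => h t), discountedMean]
  refine tsum_congr fun t => ?_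
  congr 1
  have h1 := integral_chain_reward M π (PMF.pure (x, a)) hB (c := fun _ => 1) (by simp) 0
    (fun _ => 1) t
  have h2 := integral_chain M π (PMF.pure (x, a)) (c := fun _ => 1) (by simp) (n := 0)
    (H := fun _ => 1) (K := 1) measurable_const (by simp) (fun _ => rfl) (meanReward M) t
  simp only [Finset.prod_const_one, one_mul, zero_add] at h1 h2
  rw [h1, h2]
  obtain ⟨C, hC⟩ := exists_abs_le ((weightedMean M π fun _ => 1)^[t] (meanReward M))
  rw [integral_trajLaw_zero M π _
    (g := fun s => ((weightedMean M π fun _ => 1)^[t] (meanReward M)) (s.1, s.2.1)) (C := C)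
    ((measurable_of_finite _).comp (by fun_prop)) (fun z => ae_of_all _ fun s => hC _)]
  simp_rw [integral_emitKernel_pair]
  rw [Finset.sum_eq_single (x, a)]
  · simp
  · intro z _ hz
    rw [PMF.pure_apply, if_neg hz]; simp
  · simp

lemma bellmanResidual_qValue {B : ℝ}
    (hB : ∀ x a, ∀ᵐ r ∂(M.reward x a : Measure ℝ), |r| ≤ B) (z : X × A) :
    bellmanResidual M π (qValue M π) z = 0 := by
  have h1 : (fun z : X × A => qValue M π z.1 z.2) =
      discountedMean M π (fun _ => 1) (meanReward M) := by
    ext z; exact qValue_eq_discountedMean M π hB z.1 z.2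
  have h2 := discountedMean_eq M π (c := fun _ => 1) (by simp) (meanReward M) z
  rw [bellmanResidual, h1, qValue_eq_discountedMean M π hB, h2]
  simp only [weightedMean, one_mul]
  ring

/-- At an absorbing state without reward the Bellman equation bounds the largest absolute value by
`γ` times itself. The limit therefore agrees with the iterates at terminal states, where they never
move from zero. -/
lemma qValue_terminal {B : ℝ}
    (hB : ∀ x a, ∀ᵐ r ∂(M.reward x a : Measure ℝ), |r| ≤ B) {x : X} (hx : x ∈ M.terminal) (a : A) :
    qValue M π x a = 0 := by
  have : Nonempty A := ⟨a⟩
  obtain ⟨a₀, ha₀⟩ := Finite.exists_max fun a => |qValue M π x a|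
  have h1 := bellmanResidual_qValue M π hB (x, a₀)
  have h2 : meanReward M (x, a₀) = 0 := by
    simp [meanReward, M.reward_terminal x hx]
  have h3 : pairMean M π (fun z => qValue M π z.1 z.2) (x, a₀) =
      ∑ a, (π x a).toReal * qValue M π x a := by
    rw [pairMean_eq_sum, Fintype.sum_prod_type, Finset.sum_eq_single x]
    · simp [M.P_terminal x hx]
    · intro x' _ hx'
      simp [M.P_terminal x hx, PMF.pure_apply, hx']
    · simp
  rw [bellmanResidual, h2, h3, zero_add, sub_eq_zero] at h1
  have h4 : |qValue M π x a₀| ≤ M.γ * |qValue M π x a₀| := by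
    conv_lhs => rw [← h1]
    rw [abs_mul, abs_of_nonneg M.γ_nonneg]
    exact mul_le_mul_of_nonneg_left (abs_sum_policy_le π x ha₀) M.γ_nonneg
  have h5 : |qValue M π x a₀| ≤ 0 := by
    by_contra h
    have := mul_lt_mul_of_pos_right M.γ_lt_one (not_le.1 h)
    linarith
  exact abs_nonpos_iff.1 ((ha₀ a).trans h5)

end Expected

/-! ### Continuity and strict monotonicity of the contraction rate -/

lemma prod_eq_one_of_prod_eq_prod {ι : Type*} {c : ι → ℝ} (hc0 : ∀ i, 0 ≤ c i) (hc1 : ∀ i, c i ≤ 1)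
    {α β : ℝ} (hα0 : 0 ≤ α) (hαβ : α < β) (hβ1 : β ≤ 1) (s : Finset ι)
    (h : ∏ i ∈ s, ((1 - α) + α * c i) = ∏ i ∈ s, ((1 - β) + β * c i)) : ∀ i ∈ s, c i = 1 := by
  classical
  have hpos : ∀ i, 0 < (1 - α) + α * c i := fun i => by
    have := mul_nonneg hα0 (hc0 i); linarith
  have hnn : ∀ i, 0 ≤ (1 - β) + β * c i := fun i => by
    have := mul_nonneg (hα0.trans hαβ.le) (hc0 i); linarith
  have hle : ∀ i, (1 - β) + β * c i ≤ (1 - α) + α * c i := fun i => by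
    nlinarith [mul_nonneg (sub_nonneg.2 hαβ.le) (sub_nonneg.2 (hc1 i))]
  induction s using Finset.induction_on with
  | empty => simp
  | insert j s hj ih =>
    rw [Finset.prod_insert hj, Finset.prod_insert hj] at h
    have hp : 0 < ∏ i ∈ s, ((1 - α) + α * c i) := Finset.prod_pos fun i _ => hpos i
    have hq : ∏ i ∈ s, ((1 - β) + β * c i) ≤ ∏ i ∈ s, ((1 - α) + α * c i) :=
      Finset.prod_le_prod (fun i _ => hnn i) fun i _ => hle i
    have h1 : (1 - α) + α * c j = (1 - β) + β * c j := by
      refine le_antisymm (le_of_mul_le_mul_right ?_ hp) (hle j)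
      rw [h]
      exact mul_le_mul_of_nonneg_left hq (hnn j)
    have h2 : c j = 1 := by
      have : (β - α) * (1 - c j) = 0 := by linarith
      rcases mul_eq_zero.1 this with h3 | h3 <;> linarith
    have h3 := ih (by rw [← h1] at h; exact mul_left_cancel₀ (hpos j).ne' h)
    intro i hi
    rcases Finset.mem_insert.1 hi with rfl | hi
    · exact h2
    · exact h3 i hi

section ContractionRate

variable {X A : Type*} [Fintype X] [Fintype A] [MeasurableSpace X] [MeasurableSpace A]
  [MeasurableSingletonClass X] [MeasurableSingletonClass A]

variable (M : EpisodicMDP X A) (π μ : Policy X A) (ν : PMF (X × A))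

omit [Fintype X] [Fintype A] [MeasurableSpace X] [MeasurableSpace A]
  [MeasurableSingletonClass X] [MeasurableSingletonClass A]

/-- The weight `(1 - α) + α min (1, π / μ)`. -/
def mixWeight (α : I) (z : X × A) : ℝ := (1 - (α : ℝ)) + (α : ℝ) * truncWeight π μ z.1 z.2

/-- The discounted sum of the products of weights. -/
def traceSum (α : I) (τ : Traj X A) : ℝ :=
  ∑' t : ℕ, M.γ ^ t * ∏ s ∈ Finset.Icc 1 t, mixWeight π μ α ((τ s).1, (τ s).2.1)

lemma contractionEst_eq (α : I) (τ : Traj X A) :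
    contractionEst M π μ α τ = 1 - (1 - M.γ) * traceSum M π μ α τ := rfl

lemma mixWeight_nonneg (α : I) (z : X × A) : 0 ≤ mixWeight π μ α z :=
  add_nonneg (sub_nonneg.2 α.2.2) (mul_nonneg α.2.1 (truncWeight_nonneg _ _ _ _))

lemma mixWeight_le_one (α : I) (z : X × A) : mixWeight π μ α z ≤ 1 := by
  have := mul_le_mul_of_nonneg_left (truncWeight_le_one π μ z.1 z.2) α.2.1
  unfold mixWeight; linarith

lemma abs_mixWeight_le_one (α : I) (z : X × A) : |mixWeight π μ α z| ≤ 1 := by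
  rw [abs_of_nonneg (mixWeight_nonneg π μ α z)]; exact mixWeight_le_one π μ α z

lemma mixWeight_anti {α β : I} (h : α ≤ β) (z : X × A) :
    mixWeight π μ β z ≤ mixWeight π μ α z := by
  have h' : (α : ℝ) ≤ β := h
  have := mul_nonneg (sub_nonneg.2 h') (sub_nonneg.2 (truncWeight_le_one π μ z.1 z.2))
  unfold mixWeight; linarith

lemma abs_prod_mixWeight_le (α : I) (τ : Traj X A) (s : Finset ℕ) :
    |∏ u ∈ s, mixWeight π μ α ((τ u).1, (τ u).2.1)| ≤ 1 :=
  abs_prod_le_one (abs_mixWeight_le_one π μ α) s τ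

lemma summable_traceSum (α : I) (τ : Traj X A) :
    Summable fun t => M.γ ^ t * ∏ s ∈ Finset.Icc 1 t, mixWeight π μ α ((τ s).1, (τ s).2.1) :=
  summable_discounted M.γ_nonneg M.γ_lt_one fun _ => abs_prod_mixWeight_le π μ α τ _

lemma abs_traceSum_le (α : I) (τ : Traj X A) : |traceSum M π μ α τ| ≤ 1 / (1 - M.γ) :=
  abs_tsum_discounted_le M.γ_nonneg M.γ_lt_one fun _ => abs_prod_mixWeight_le π μ α τ _

lemma abs_contractionEst_le (α : I) (τ : Traj X A) : |contractionEst M π μ α τ| ≤ 2 := by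
  have h := abs_traceSum_le M π μ α τ
  have h1 : 0 < 1 - M.γ := sub_pos.2 M.γ_lt_one
  rw [contractionEst_eq]
  refine (abs_sub _ _).trans ?_
  rw [abs_one, abs_mul, abs_of_pos h1]
  have := mul_le_mul_of_nonneg_left h h1.le
  rw [mul_one_div_cancel h1.ne'] at this
  linarith

lemma continuous_traceSum (τ : Traj X A) : Continuous fun α => traceSum M π μ α τ := by
  refine continuous_tsum (fun t => ?_) (summable_geometric_of_lt_one M.γ_nonneg M.γ_lt_one)
    fun t α => ?_
  · unfold mixWeight; fun_prop
  · rw [Real.norm_eq_abs, abs_mul, abs_of_nonneg (pow_nonneg M.γ_nonneg t)]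
    exact mul_le_of_le_one_right (pow_nonneg M.γ_nonneg t) (abs_prod_mixWeight_le π μ α τ _)

/-- The two series are ordered termwise, so equal sums force equal terms, and equal products force
all ratios involved to be `1`. Terms with `γ ^ t = 0` give no information but do not contribute
either. -/
lemma traceSum_eq_of_eq {α β : I} (h : α < β) {τ : Traj X A}
    (he : traceSum M π μ α τ = traceSum M π μ β τ) : traceSum M π μ 1 τ = (1 - M.γ)⁻¹ := by
  rw [← tsum_geometric_of_lt_one M.γ_nonneg M.γ_lt_one]
  refine tsum_congr fun t => ?_
  have hle : ∀ t, M.γ ^ t * ∏ s ∈ Finset.Icc 1 t, mixWeight π μ β ((τ s).1, (τ s).2.1) ≤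
      M.γ ^ t * ∏ s ∈ Finset.Icc 1 t, mixWeight π μ α ((τ s).1, (τ s).2.1) := fun t =>
    mul_le_mul_of_nonneg_left (Finset.prod_le_prod (fun s _ => mixWeight_nonneg _ _ _ _)
      fun s _ => mixWeight_anti π μ h.le _) (pow_nonneg M.γ_nonneg t)
  have heq : M.γ ^ t * ∏ s ∈ Finset.Icc 1 t, mixWeight π μ α ((τ s).1, (τ s).2.1) =
      M.γ ^ t * ∏ s ∈ Finset.Icc 1 t, mixWeight π μ β ((τ s).1, (τ s).2.1) := by
    by_contra hne
    exact absurd he (Summable.tsum_lt_tsum hle (lt_of_le_of_ne (hle t) (Ne.symm hne))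
      (summable_traceSum M π μ β τ) (summable_traceSum M π μ α τ)).ne'
  obtain h0 | h0 := (pow_nonneg M.γ_nonneg t).eq_or_lt
  · rw [← h0, zero_mul]
  · have h1 := prod_eq_one_of_prod_eq_prod
      (c := fun s => truncWeight π μ (τ s).1 (τ s).2.1) (fun s => truncWeight_nonneg _ _ _ _)
      (fun s => truncWeight_le_one _ _ _ _) α.2.1 h β.2.2 _ (mul_left_cancel₀ h0.ne' heq)
    rw [Finset.prod_eq_one, mul_one]
    intro s hs
    simp only [mixWeight, h1 s hs]
    ring

variable [Fintype X] [Fintype A] [MeasurableSpace X] [MeasurableSpace A]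
  [MeasurableSingletonClass X] [MeasurableSingletonClass A]

lemma measurable_traceSum (α : I) : Measurable (traceSum M π μ α) :=
  Measurable.tsum fun _ => (measurable_chain (mixWeight π μ α) _).const_mul _

lemma integrable_traceSum (α : I) : Integrable (traceSum M π μ α) (trajLaw M μ ν) :=
  (integrable_const _).mono' (measurable_traceSum M π μ α).aestronglyMeasurable
    (ae_of_all _ (abs_traceSum_le M π μ α))

lemma measurable_uncurry_contractionEst :
    Measurable (Function.uncurry fun (α : I) (τ : Traj X A) => contractionEst M π μ α τ) := by
  have h1 : ∀ s : ℕ, Measurable fun p : I × Traj X A =>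
      truncWeight π μ (p.2 s).1 (p.2 s).2.1 := fun s =>
    (measurable_pair_comp (fun z => truncWeight π μ z.1 z.2) s).comp measurable_snd
  have h2 : ∀ s : ℕ, Measurable fun p : I × Traj X A =>
      mixWeight π μ p.1 ((p.2 s).1, (p.2 s).2.1) := fun s => by
    have := h1 s
    unfold mixWeight
    fun_prop
  have h3 : Measurable fun p : I × Traj X A => traceSum M π μ p.1 p.2 :=
    Measurable.tsum fun _ => (Finset.measurable_fun_prod _ fun s _ => h2 s).const_mul _
  exact measurable_const.sub (h3.const_mul _)

lemma integral_traceSum (α : I) :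
    ∫ τ, traceSum M π μ α τ ∂trajLaw M μ ν =
      ∑ z, (ν z).toReal * discountedMean M μ (mixWeight π μ α) (fun _ => 1) z := by
  have e1 : ∫ τ, traceSum M π μ α τ ∂trajLaw M μ ν =
      ∑' t, M.γ ^ t * ∫ τ, ∏ s ∈ Finset.Icc 1 t, mixWeight π μ α ((τ s).1, (τ s).2.1)
        ∂trajLaw M μ ν :=
    integral_tsum_discounted M.γ_nonneg M.γ_lt_one (C := 1) (fun t => measurable_chain _ _)
      fun t => ae_of_all _ fun τ => abs_prod_mixWeight_le π μ α τ _
  have hb := abs_iterate_weightedMean_le M μ (abs_mixWeight_le_one π μ α) (f := fun _ => 1)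
    (C := 1) (by simp)
  have e2 : ∀ t, ∫ τ, ∏ s ∈ Finset.Icc 1 t, mixWeight π μ α ((τ s).1, (τ s).2.1)
      ∂trajLaw M μ ν = ∑ z, (ν z).toReal *
        ((weightedMean M μ (mixWeight π μ α))^[t] fun _ => 1) z := fun t => by
    have h2 := integral_chain M μ ν (abs_mixWeight_le_one π μ α) (n := 0)
      (H := fun _ => 1) (K := 1) measurable_const (by simp) (fun _ => rfl) (fun _ => 1) t
    have h3 : Finset.Icc 1 t = Finset.Ioc 0 t := rfl
    simp only [one_mul, mul_one, zero_add] at h2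
    rw [h3, h2, integral_trajLaw_zero M μ ν (C := 1)
      (g := fun s => ((weightedMean M μ (mixWeight π μ α))^[t] fun _ => 1) (s.1, s.2.1))
      ((measurable_of_finite _).comp (by fun_prop)) (fun z => ae_of_all _ fun s => hb _ _)]
    simp_rw [integral_emitKernel_pair]
  rw [e1]
  simp_rw [e2, discountedMean, ← tsum_mul_left, Finset.mul_sum]
  rw [Summable.tsum_finsetSum]
  · exact Finset.sum_congr rfl fun z _ => tsum_congr fun t => by ring
  · intro z _
    refine ((summable_discounted M.γ_nonneg M.γ_lt_one fun t => hb t z).mul_left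
      (ν z).toReal).congr fun t => by ring

/-- The trace mean is linear in the initial law, so averaging point starts over `ν` is the same as
starting from `ν`. -/
lemma avgContractionRate_eq (α : I) : avgContractionRate M π μ ν α =
    1 - (1 - M.γ) * ∫ τ, traceSum M π μ α τ ∂trajLaw M μ ν := by
  have e1 : ∀ z : X × A, contractionRate M π μ α z.1 z.2 =
      1 - (1 - M.γ) * discountedMean M μ (mixWeight π μ α) (fun _ => 1) z := fun z => by
    have := integral_traceSum M π μ (PMF.pure z) α
    rw [Finset.sum_eq_single z] at this
    · rw [PMF.pure_apply, if_pos rfl, ENNReal.toReal_one, one_mul] at this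
      rw [← this]
      rfl
    · intro z' _ hz'
      rw [PMF.pure_apply, if_neg hz']; simp
    · simp
  rw [avgContractionRate]
  simp_rw [e1]
  rw [PMF.integral_eq_sum, integral_traceSum, Finset.mul_sum]
  simp only [smul_eq_mul, mul_sub, mul_one, Finset.sum_sub_distrib, sum_toReal_eq_one]
  congr 1
  exact Finset.sum_congr rfl fun z _ => by ring

lemma integral_contractionEst (α : I) :
    ∫ τ, contractionEst M π μ α τ ∂trajLaw M μ ν = avgContractionRate M π μ ν α := by
  simp_rw [contractionEst_eq]
  rw [integral_sub (integrable_const _) ((integrable_traceSum M π μ ν α).const_mul _),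
    integral_const_mul, avgContractionRate_eq]
  simp

lemma continuous_avgContractionRate : Continuous (avgContractionRate M π μ ν) := by
  have : Continuous fun α => ∫ τ, traceSum M π μ α τ ∂trajLaw M μ ν :=
    continuous_of_dominated (fun α => (measurable_traceSum M π μ α).aestronglyMeasurable)
      (fun α => ae_of_all _ (abs_traceSum_le M π μ α)) (integrable_const _)
      (ae_of_all _ (continuous_traceSum M π μ))
  rw [funext (avgContractionRate_eq M π μ ν)]
  fun_prop

lemma avgContractionRate_zero : avgContractionRate M π μ ν 0 = 0 := by
  have h1 : 1 - M.γ ≠ 0 := (sub_pos.2 M.γ_lt_one).ne'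
  have : ∀ τ, traceSum M π μ 0 τ = (1 - M.γ)⁻¹ := fun τ => by
    simp [traceSum, mixWeight, tsum_geometric_of_lt_one M.γ_nonneg M.γ_lt_one]
  simp [avgContractionRate_eq, this, h1]

/-- If the rates at `α < β` agreed, the ordered traces would agree almost surely, and
`traceSum_eq_of_eq` would make the rate at `1` zero. -/
lemma strictMono_avgContractionRate (h1 : 0 < avgContractionRate M π μ ν 1) :
    StrictMono (avgContractionRate M π μ ν) := by
  intro α β hαβ
  have hγ : 0 < 1 - M.γ := sub_pos.2 M.γ_lt_one
  have hle : ∀ τ, traceSum M π μ β τ ≤ traceSum M π μ α τ := fun τ =>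
    Summable.tsum_le_tsum (fun t => mul_le_mul_of_nonneg_left
      (Finset.prod_le_prod (fun s _ => mixWeight_nonneg _ _ _ _)
        fun s _ => mixWeight_anti π μ hαβ.le _) (pow_nonneg M.γ_nonneg t))
      (summable_traceSum M π μ β τ) (summable_traceSum M π μ α τ)
  have hint := integral_mono (integrable_traceSum M π μ ν β) (integrable_traceSum M π μ ν α) hle
  have hlt : ∫ τ, traceSum M π μ β τ ∂trajLaw M μ ν < ∫ τ, traceSum M π μ α τ ∂trajLaw M μ ν := by
    refine lt_of_le_of_ne hint fun he => h1.ne' ?_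
    have hae := (integral_eq_iff_of_ae_le (integrable_traceSum M π μ ν β)
      (integrable_traceSum M π μ ν α) (ae_of_all _ hle)).1 he
    have hae1 : ∀ᵐ τ ∂trajLaw M μ ν, traceSum M π μ 1 τ = (1 - M.γ)⁻¹ :=
      hae.mono fun τ hτ => traceSum_eq_of_eq M π μ hαβ hτ.symm
    rw [avgContractionRate_eq, integral_congr_ae hae1]
    simp [hγ.ne']
  rw [avgContractionRate_eq, avgContractionRate_eq]
  have := mul_lt_mul_of_pos_left hlt hγ
  linarith

end ContractionRate

/-! ### Joint measurability of the updates -/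

section UpdateMeasurable

variable {X A : Type*} [Fintype X] [Fintype A] [MeasurableSpace X] [MeasurableSpace A]
  [MeasurableSingletonClass X] [MeasurableSingletonClass A]

variable (M : EpisodicMDP X A) (π μ : Policy X A)

omit [Fintype X] [Fintype A] [MeasurableSpace X] [MeasurableSpace A]
  [MeasurableSingletonClass X] [MeasurableSingletonClass A] in
lemma mix_toReal (α : I) (x : X) (a : A) :
    (mix α π μ x a).toReal = α * (π x a).toReal + (1 - α) * (μ x a).toReal := by
  change (ENNReal.ofReal (α : ℝ) * π x a + ENNReal.ofReal (1 - (α : ℝ)) * μ x a).toReal = _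
  rw [ENNReal.toReal_add (ENNReal.mul_ne_top ENNReal.ofReal_ne_top ((π x).apply_ne_top a))
    (ENNReal.mul_ne_top ENNReal.ofReal_ne_top ((μ x).apply_ne_top a)), ENNReal.toReal_mul,
    ENNReal.toReal_mul, ENNReal.toReal_ofReal α.2.1, ENNReal.toReal_ofReal (sub_nonneg.2 α.2.2)]

omit [Fintype X] [Fintype A] [MeasurableSpace X] [MeasurableSpace A]
  [MeasurableSingletonClass X] [MeasurableSingletonClass A] in
lemma measurable_countable_param {P Z : Type*} [MeasurableSpace P] [MeasurableSpace Z]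
    [Countable Z] [MeasurableSingletonClass Z] {f : Z → P → ℝ}
    (hf : ∀ z, Measurable (f z)) {g : P → Z} (hg : Measurable g) :
    Measurable fun p => f (g p) p :=
  (measurable_from_prod_countable_right (f := fun q : Z × P => f q.1 q.2) hf).comp
    (hg.prodMk measurable_id)

omit [Fintype X] [Fintype A] [MeasurableSpace X] [MeasurableSpace A]
  [MeasurableSingletonClass X] [MeasurableSingletonClass A] in
lemma measurable_mix (x : X) (a : A) : Measurable fun α : I => (mix α π μ x a).toReal := by
  simp_rw [mix_toReal]; fun_prop

variable {P : Type*} [MeasurableSpace P] {α : P → I} {Q : P → X → A → ℝ} {τ : P → Traj X A}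

omit [Fintype X] [Fintype A] [MeasurableSingletonClass X] [MeasurableSingletonClass A] in
lemma measurable_pair_at (hτ : Measurable τ) (s : ℕ) :
    Measurable fun p => ((τ p s).1, (τ p s).2.1) := by
  have : Measurable fun p => τ p s := (measurable_pi_apply s).comp hτ
  fun_prop

lemma measurable_pair_param {F : X × A → P → ℝ} (hF : ∀ z, Measurable (F z)) (hτ : Measurable τ)
    (s : ℕ) : Measurable fun p => F ((τ p s).1, (τ p s).2.1) p :=
  measurable_countable_param hF (measurable_pair_at hτ s)

lemma measurable_truncWeight_mix (hα : Measurable α) (hτ : Measurable τ) (s : ℕ) :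
    Measurable fun p => truncWeight (mix (α p) π μ) μ (τ p s).1 (τ p s).2.1 :=
  measurable_pair_param (F := fun z p => truncWeight (mix (α p) π μ) μ z.1 z.2)
    (fun z => measurable_const.min (((measurable_mix π μ z.1 z.2).comp hα).div_const _)) hτ s

lemma measurable_tdError_mix (hα : Measurable α) (hQ : Measurable Q) (hτ : Measurable τ) (s : ℕ) :
    Measurable fun p => tdError M (mix (α p) π μ) (Q p) (τ p) s := by
  have hQ' : ∀ (x : X) (a : A), Measurable fun p => Q p x a := fun x a =>
    (measurable_pi_apply a).comp ((measurable_pi_apply x).comp hQ)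
  have hr : Measurable fun p => (τ p s).2.2 :=
    measurable_snd.comp (measurable_snd.comp ((measurable_pi_apply s).comp hτ))
  have h1 : Measurable fun p => ∑ a, (mix (α p) π μ (τ p (s + 1)).1 a).toReal *
      Q p (τ p (s + 1)).1 a :=
    measurable_pair_param (F := fun z p => ∑ a, (mix (α p) π μ z.1 a).toReal * Q p z.1 a)
      (fun z => Finset.measurable_fun_sum _ fun a _ =>
        ((measurable_mix π μ z.1 a).comp hα).mul (hQ' z.1 a)) hτ (s + 1)
  have h2 : Measurable fun p => Q p (τ p s).1 (τ p s).2.1 :=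
    measurable_pair_param (F := fun z p => Q p z.1 z.2) (fun z => hQ' z.1 z.2) hτ s
  exact (hr.add (h1.const_mul _)).sub h2

open Classical in
lemma measurable_updateSum_mix (hα : Measurable α) (hQ : Measurable Q) (hτ : Measurable τ)
    (z : X × A) : Measurable fun p => updateSum M (mix (α p) π μ) μ (Q p) (τ p) z := by
  -- The summation ranges depend on the trajectory; fixing the value of its length leaves finite
  -- sums with deterministic ranges.
  refine measurable_countable_param (g := fun p => (trajLength M (τ p)).toNat)
    (f := fun n p => ∑ t ∈ Finset.range n, if (τ p t).1 = z.1 ∧ (τ p t).2.1 = z.2 then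
      ∑ s ∈ Finset.Ico t n, M.γ ^ (s - t) *
        (∏ u ∈ Finset.Ioc t s, truncWeight (mix (α p) π μ) μ (τ p u).1 (τ p u).2.1) *
          tdError M (mix (α p) π μ) (Q p) (τ p) s else 0)
    (fun n => Finset.measurable_fun_sum _ fun t _ => Measurable.ite ?_
      (Finset.measurable_fun_sum _ fun s _ => ((Finset.measurable_fun_prod _ fun u _ =>
        measurable_truncWeight_mix π μ hα hτ u).const_mul _).mul
          (measurable_tdError_mix M π μ hα hQ hτ s)) measurable_const)
    ((measurable_trajLength_toNat M).comp hτ)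
  exact measurable_pair_at hτ t
    (Set.toFinite {z' : X × A | z'.1 = z.1 ∧ z'.2 = z.2}).measurableSet

end UpdateMeasurable

/-! ### The mixture parameter and the running maximum -/

/-- Convergence of the Robbins-Monro iteration for an increasing function on the unit interval,
parametrized by the sigmoid. -/
lemma tendsto_sigmoid_of_robbinsMonro {φ ε N : ℕ → ℝ} {C : I → ℝ} {Γ K L : ℝ} {αs : I}
    (hC : StrictMono C) (hαs : C αs = Γ) (hK : ∀ α, |C α - Γ| ≤ K)
    (hε0 : ∀ k, 0 ≤ ε k) (hε : Tendsto ε atTop (𝓝 0)) (hε1 : ¬ Summable ε)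
    (hN : Tendsto (fun n => ∑ k ∈ Finset.range n, N k) atTop (𝓝 L))
    (hrec : ∀ k, φ (k + 1) = φ k - ε k * (C (unitInterval.sigmoid (φ k)) - Γ) + N k) :
    Tendsto (fun k => unitInterval.sigmoid (φ k)) atTop (𝓝 αs) := by
  have hsig : ∀ {c : I}, 0 < c → c < 1 → ∃ a, unitInterval.sigmoid a = c := fun {c} h0 h1 => by
    have : c ∈ Set.range unitInterval.sigmoid := by
      rw [unitInterval.range_sigmoid]; exact ⟨h0, h1⟩
    exact this
  refine tendsto_order.2 ⟨fun b hb => ?_, fun b hb => ?_⟩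
  -- Two intermediate levels: `c₂ < αs` makes the drift uniformly positive below it, and the gap
  -- from `c₁` to `c₂` is the slack `δ`. Both lie strictly inside the unit interval even if `αs =
  -- 1`.
  · obtain ⟨c₁, hbc, hc₁⟩ := exists_between hb
    obtain ⟨c₂, hc₁₂, hc₂⟩ := exists_between hc₁
    have h0 : (0 : I) < c₁ := lt_of_le_of_lt unitInterval.nonneg' hbc
    obtain ⟨a₁, rfl⟩ := hsig h0 (hc₁.trans_le unitInterval.le_one')
    obtain ⟨a₂, rfl⟩ := hsig (h0.trans hc₁₂) (hc₂.trans_le unitInterval.le_one')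
    have h := eventually_ge_of_robbinsMonro (φ := φ) (a := a₂)
      (v := fun k => Γ - C (unitInterval.sigmoid (φ k)))
      (c := Γ - C (unitInterval.sigmoid a₂)) (C := K) (by rw [← hαs]; exact sub_pos.2 (hC hc₂))
      hε0 hε hε1 hN (fun k => by rw [hrec]; ring) (fun k => by rw [abs_sub_comm]; exact hK _)
      (fun k hk => sub_le_sub_left (hC.monotone (unitInterval.sigmoid_le hk)) _)
      (sub_pos.2 (unitInterval.sigmoid_lt_iff.1 hc₁₂))
    filter_upwards [h] with k hk
    refine hbc.trans_le (unitInterval.sigmoid_le ?_)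
    linarith
  -- The mirror image, applied to `-φ`; it is vacuous when `αs = 1`.
  · obtain ⟨c₁, hc₁, hbc⟩ := exists_between hb
    obtain ⟨c₂, hc₂, hc₁₂⟩ := exists_between hc₁
    have h0 : (0 : I) < c₂ := lt_of_le_of_lt unitInterval.nonneg' hc₂
    have h1 : c₁ < 1 := hbc.trans_le unitInterval.le_one'
    obtain ⟨a₁, rfl⟩ := hsig (h0.trans hc₁₂) h1
    obtain ⟨a₂, rfl⟩ := hsig h0 (hc₁₂.trans h1)
    have h := eventually_ge_of_robbinsMonro (φ := fun k => -φ k) (a := -a₂)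
      (v := fun k => C (unitInterval.sigmoid (φ k)) - Γ) (N := fun k => -N k) (L := -L)
      (c := C (unitInterval.sigmoid a₂) - Γ) (C := K) (by rw [← hαs]; exact sub_pos.2 (hC hc₂))
      hε0 hε hε1 (by simpa using hN.neg) (fun k => by rw [hrec]; ring) (fun k => hK _)
      (fun k hk => sub_le_sub_right (hC.monotone (unitInterval.sigmoid_le (neg_le_neg_iff.1 hk))) _)
      (sub_pos.2 (unitInterval.sigmoid_lt_iff.1 hc₁₂))
    filter_upwards [h] with k hk
    refine lt_of_le_of_lt (unitInterval.sigmoid_le ?_) hbc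
    linarith

/-- The running maximum of a sequence. -/
def runningMax (a : ℕ → ℝ) : ℕ → ℝ
  | 0 => a 0
  | k + 1 => max (runningMax a k) (a (k + 1))

lemma le_runningMax (a : ℕ → ℝ) : ∀ k, a k ≤ runningMax a k
  | 0 => le_rfl
  | _ + 1 => le_max_right _ _

lemma monotone_runningMax (a : ℕ → ℝ) : Monotone (runningMax a) :=
  monotone_nat_of_le_succ fun _ => le_max_left _ _

/-! ### Perturbed contraction, adaptedness and normalization -/

section Main

variable {X A : Type*} [Fintype X] [Fintype A] [MeasurableSpace X] [MeasurableSpace A]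
  [MeasurableSingletonClass X] [MeasurableSingletonClass A]

variable (M : EpisodicMDP X A) (π μ : Policy X A) (ν : PMF (X × A))

lemma pairMean_mix (α : I) (f : X × A → ℝ) (z : X × A) :
    pairMean M (mix α π μ) f z = α * pairMean M π f z + (1 - α) * pairMean M μ f z := by
  simp only [pairMean_eq_sum, mix_toReal, Finset.mul_sum, ← Finset.sum_add_distrib]
  exact Finset.sum_congr rfl fun z' _ => by ring

/-- The Retrace operator for the mixture `α` contracts towards the value function of the
mixture `β`, up to an error controlled by the distance from `α` to `β`. -/
lemma abs_retrace_sub_qValue_le {B : ℝ}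
    (hB : ∀ x a, ∀ᵐ r ∂(M.reward x a : Measure ℝ), |r| ≤ B) (α β : I) {Q : X → A → ℝ} {ξ q : ℝ}
    (hξ : ∀ z : X × A, |Q z.1 z.2 - qValue M (mix β π μ) z.1 z.2| ≤ ξ)
    (hq : ∀ z : X × A, |qValue M (mix β π μ) z.1 z.2| ≤ q) (z : X × A) :
    |discountedMean M μ (fun z => truncWeight (mix α π μ) μ z.1 z.2)
        (bellmanResidual M (mix α π μ) Q) z + (Q z.1 z.2 - qValue M (mix β π μ) z.1 z.2)| ≤
      M.γ * ξ + |(α : ℝ) - β| * (2 * q) / (1 - M.γ) := by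
  set qs : X × A → ℝ := fun z => qValue M (mix β π μ) z.1 z.2 with hqs
  -- The error `e` is the Bellman residual, for the mixture `α`, of the value function of the
  -- mixture `β`, whose own residual is zero.
  refine abs_retrace_contraction M (mix α π μ) μ
    (c := fun z => truncWeight (mix α π μ) μ z.1 z.2) (x := fun z => Q z.1 z.2 - qs z)
    (e := fun z => M.γ * (((α : ℝ) - β) * (pairMean M π qs z - pairMean M μ qs z)))
    (fun z => truncWeight_nonneg _ _ _ _) (fun z => truncWeight_le_one _ _ _ _)
    (fun z => mul_truncWeight_le _ _ _ _) hξ (fun z => ?_) (fun z => ?_) z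
  · rw [abs_mul, abs_mul, abs_of_nonneg M.γ_nonneg]
    refine (mul_le_of_le_one_left (by positivity) M.γ_lt_one.le).trans
      (mul_le_mul_of_nonneg_left ?_ (abs_nonneg _))
    have h1 := abs_pairMean_le M π hq z
    have h2 := abs_pairMean_le M μ hq z
    exact (abs_sub _ _).trans (by rw [two_mul]; exact add_le_add h1 h2)
  · rw [discountedMean_eq M μ fun z => abs_truncWeight_le_one (mix α π μ) μ z.1 z.2]
    congr 1
    have h1 := bellmanResidual_qValue M (mix β π μ) hB z
    have h2 : pairMean M (mix α π μ) (fun z => Q z.1 z.2 - qs z) z =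
        pairMean M (mix α π μ) (fun z => Q z.1 z.2) z - pairMean M (mix α π μ) qs z := by
      simp only [pairMean_eq_sum, ← Finset.sum_sub_distrib]
      exact Finset.sum_congr rfl fun z' _ => by ring
    rw [bellmanResidual, pairMean_mix] at h1
    rw [h2, bellmanResidual, pairMean_mix M π μ α qs]
    simp only [hqs] at h1 ⊢
    linarith

variable (Γ : ℝ) (ε : ℕ → ℝ) (φ₀ : ℝ) (Q₀ : X → A → ℝ) {Ω : Type*} [mΩ : MeasurableSpace Ω]
  {w : ℕ → Ω → Traj X A} (hw : ∀ k, Measurable (w k))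

include hw in
lemma measurable_phiSeq (k : ℕ) : Measurable[pastFiltration w hw k]
    fun ω => phiSeq M π μ Γ ε φ₀ (fun j => w j ω) k := by
  induction k with
  | zero => exact measurable_const
  | succ k ih =>
    have h1 : Measurable[pastFiltration w hw (k + 1)]
        fun ω => phiSeq M π μ Γ ε φ₀ (fun j => w j ω) k :=
      ih.mono ((pastFiltration w hw).mono k.le_succ) le_rfl
    have h2 : Measurable[pastFiltration w hw (k + 1)] (w k) :=
      measurable_pastFiltration hw k.lt_succ_self
    exact h1.sub ((((measurable_uncurry_contractionEst M π μ).comp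
      ((unitInterval.continuous_sigmoid.measurable.comp h1).prodMk h2)).sub_const Γ).const_mul _)

include hw in
lemma measurable_qSeq (k : ℕ) : Measurable[pastFiltration w hw k]
    fun ω => qSeq M π μ Γ ε φ₀ Q₀ (fun j => w j ω) k := by
  induction k with
  | zero => exact measurable_const
  | succ k ih =>
    have h1 : Measurable[pastFiltration w hw (k + 1)]
        fun ω => qSeq M π μ Γ ε φ₀ Q₀ (fun j => w j ω) k :=
      ih.mono ((pastFiltration w hw).mono k.le_succ) le_rfl
    have h2 : Measurable[pastFiltration w hw (k + 1)] (w k) :=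
      measurable_pastFiltration hw k.lt_succ_self
    have h3 : Measurable[pastFiltration w hw (k + 1)]
        fun ω => unitInterval.sigmoid (phiSeq M π μ Γ ε φ₀ (fun j => w j ω) k) :=
      unitInterval.continuous_sigmoid.measurable.comp
        ((measurable_phiSeq M π μ Γ ε φ₀ hw k).mono ((pastFiltration w hw).mono k.le_succ) le_rfl)
    have h4 : ∀ (x : X) (a : A), Measurable fun p : (I × (X → A → ℝ)) × Traj X A =>
        retraceUpdate M (mix p.1.1 π μ) μ (ε k) p.1.2 p.2 x a := fun x a => by
      have h5 : Measurable fun p : (I × (X → A → ℝ)) × Traj X A =>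
          updateSum M (mix p.1.1 π μ) μ p.1.2 p.2 (x, a) :=
        measurable_updateSum_mix M π μ (α := fun p : (I × (X → A → ℝ)) × Traj X A => p.1.1)
          (Q := fun p => p.1.2) (τ := fun p => p.2) (by fun_prop) (by fun_prop) measurable_snd _
      simp_rw [retraceUpdate_eq]
      exact Measurable.add (by fun_prop) (h5.const_mul _)
    exact (measurable_pi_iff.2 fun x => measurable_pi_iff.2 fun a => h4 x a).comp
      ((h3.prodMk h1).prodMk h2)

omit [Fintype X] [MeasurableSpace X] [MeasurableSpace A] [MeasurableSingletonClass X]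
  [MeasurableSingletonClass A] in
lemma qSeq_terminal (hQ₀ : ∀ x ∈ M.terminal, ∀ a, Q₀ x a = 0) (v : ℕ → Traj X A) (k : ℕ) :
    ∀ x ∈ M.terminal, ∀ a, qSeq M π μ Γ ε φ₀ Q₀ v k x a = 0 := by
  induction k with
  | zero => exact hQ₀
  | succ k ih =>
    intro x hx a
    rw [qSeq, retraceUpdate_eq, ih x hx a, updateSum_terminal M _ _ _ _ (z := (x, a)) hx]
    simp

/-- The norm of an action-value function, as a function of state-action pairs. -/
def pairNorm (Q : X → A → ℝ) : ℝ := ‖fun z : X × A => Q z.1 z.2‖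

omit [MeasurableSpace X] [MeasurableSpace A] [MeasurableSingletonClass X]
  [MeasurableSingletonClass A] in
lemma abs_le_pairNorm (Q : X → A → ℝ) (x : X) (a : A) : |Q x a| ≤ pairNorm Q :=
  norm_le_pi_norm (fun z : X × A => Q z.1 z.2) (x, a)

omit [MeasurableSpace X] [MeasurableSpace A] [MeasurableSingletonClass X]
  [MeasurableSingletonClass A] in
lemma measurable_pairNorm : Measurable (pairNorm : (X → A → ℝ) → ℝ) := by
  have : Measurable fun (Q : X → A → ℝ) (z : X × A) => Q z.1 z.2 :=
    measurable_pi_iff.2 fun z => by fun_prop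
  exact this.norm

/-- The Retrace update, normalized by `max g (1 + ‖Q‖)`. -/
def normalizedUpdate (z : X × A) (s : (I × (X → A → ℝ)) × ℝ) (τ : Traj X A) : ℝ :=
  updateSum M (mix s.1.1 π μ) μ s.1.2 τ z / max s.2 (1 + pairNorm s.1.2)

lemma measurable_normalizedUpdate (z : X × A) :
    Measurable (Function.uncurry (normalizedUpdate M π μ z)) := by
  have h1 : Measurable fun p : ((I × (X → A → ℝ)) × ℝ) × Traj X A =>
      updateSum M (mix p.1.1.1 π μ) μ p.1.1.2 p.2 z :=
    measurable_updateSum_mix M π μ (α := fun p : ((I × (X → A → ℝ)) × ℝ) × Traj X A => p.1.1.1)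
      (Q := fun p => p.1.1.2) (τ := fun p => p.2) (by fun_prop) (by fun_prop) measurable_snd z
  have h2 : Measurable fun p : ((I × (X → A → ℝ)) × ℝ) × Traj X A =>
      max p.1.2 (1 + pairNorm p.1.1.2) := by
    refine Measurable.max (by fun_prop) (measurable_const.add (measurable_pairNorm.comp ?_))
    fun_prop
  exact h1.div h2

-- Dividing by at least `1 + ‖Q‖` turns the affine bound into one that is uniform in the state.
-- Taking the maximum inside `normalizedUpdate` makes this true for every `s`, not only for those
-- met by the algorithm.
omit [MeasurableSpace X] [MeasurableSpace A] [MeasurableSingletonClass X]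
  [MeasurableSingletonClass A] in
lemma abs_normalizedUpdate_le {B : ℝ} (z : X × A) (s : (I × (X → A → ℝ)) × ℝ) {τ : Traj X A}
    (hτ : ∀ n, |(τ n).2.2| ≤ B) :
    |normalizedUpdate M π μ z s τ| ≤ (trajLength M τ).toNat * ((B + 2) / (1 - M.γ)) := by
  have hB : 0 ≤ B := (abs_nonneg _).trans (hτ 0)
  have hγ : 0 < 1 - M.γ := sub_pos.2 M.γ_lt_one
  have hn : 0 ≤ pairNorm s.1.2 := norm_nonneg _
  have hm : 0 < max s.2 (1 + pairNorm s.1.2) := lt_max_of_lt_right (by linarith)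
  rw [normalizedUpdate, abs_div, abs_of_pos hm, div_le_iff₀ hm]
  refine (abs_updateSum_le M _ μ (abs_le_pairNorm s.1.2) hτ z).trans ?_
  rw [mul_assoc]
  refine mul_le_mul_of_nonneg_left ?_ (Nat.cast_nonneg _)
  rw [div_mul_eq_mul_div]
  refine div_le_div_of_nonneg_right ?_ hγ.le
  refine le_trans ?_ (mul_le_mul_of_nonneg_left (le_max_right _ _) (by linarith))
  nlinarith [mul_nonneg hB hn]

end Main

/-! ### Pathwise convergence of the action values -/

section Convergence

variable {X A : Type*} [Fintype X] [Fintype A] [MeasurableSpace X] [MeasurableSpace A]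
  [MeasurableSingletonClass X] [MeasurableSingletonClass A]

/-- Convergence of the C-trace action values along a fixed sequence of trajectories for which the
mixture parameters converge and the normalized noise is summable. -/
lemma tendsto_qSeq (M : EpisodicMDP X A) (π μ : Policy X A) (ν : PMF (X × A))
    {Γ φ₀ B : ℝ} {ε : ℕ → ℝ} (hε0 : ∀ k, 0 ≤ ε k) (hε : Tendsto ε atTop (𝓝 0))
    (hε1 : ¬ Summable ε)
    (hT : ∫⁻ τ, ((trajLength M τ : ℕ∞) : ℝ≥0∞) ^ 2 ∂(trajLaw M μ ν) < ∞)
    (hB : ∀ x a, ∀ᵐ r ∂(M.reward x a : Measure ℝ), |r| ≤ B)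
    (hcov : ∀ x, x ∉ M.terminal → ∀ a, 0 < trajLaw M μ ν {τ | ∃ t, (τ t).1 = x ∧ (τ t).2.1 = a})
    {Q₀ : X → A → ℝ} (hQ₀ : ∀ x ∈ M.terminal, ∀ a, Q₀ x a = 0) (v : ℕ → Traj X A) {αs : I}
    (hα : Tendsto (fun k => unitInterval.sigmoid (phiSeq M π μ Γ ε φ₀ v k)) atTop (𝓝 αs))
    (hnoise : ∀ z, ∃ L, Tendsto (fun n => ∑ k ∈ Finset.range n, ε k *
      (normalizedUpdate M π μ z ((unitInterval.sigmoid (phiSeq M π μ Γ ε φ₀ v k),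
        qSeq M π μ Γ ε φ₀ Q₀ v k),
          runningMax (fun k => 1 + pairNorm (qSeq M π μ Γ ε φ₀ Q₀ v k)) k) (v k) -
      ∫ τ, normalizedUpdate M π μ z ((unitInterval.sigmoid (phiSeq M π μ Γ ε φ₀ v k),
        qSeq M π μ Γ ε φ₀ Q₀ v k),
          runningMax (fun k => 1 + pairNorm (qSeq M π μ Γ ε φ₀ Q₀ v k)) k) τ ∂trajLaw M μ ν))
      atTop (𝓝 L)) :
    Tendsto (fun k => qSeq M π μ Γ ε φ₀ Q₀ v k) atTop (𝓝 (qValue M (mix αs π μ))) := by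
  classical
  set α : ℕ → I := fun k => unitInterval.sigmoid (phiSeq M π μ Γ ε φ₀ v k) with hαdef
  set Q : ℕ → X → A → ℝ := fun k => qSeq M π μ Γ ε φ₀ Q₀ v k with hQdef
  set G : ℕ → ℝ := runningMax fun k => 1 + pairNorm (Q k) with hGdef
  set P := trajLaw M μ ν with hP
  set n : ℕ → X × A → ℝ := fun k z => ε k * (normalizedUpdate M π μ z ((α k, Q k), G k) (v k) -
    ∫ τ, normalizedUpdate M π μ z ((α k, Q k), G k) τ ∂P) with hn
  have hnC : ∀ z, CauchySeq fun m => ∑ k ∈ Finset.range m, n k z := fun z =>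
    (hnoise z).choose_spec.cauchySeq
  set q : ℕ → X × A → ℝ := fun k z => Q k z.1 z.2 with hq
  set qs : X × A → ℝ := fun z => qValue M (mix αs π μ) z.1 z.2 with hqs
  have hqG : ∀ k, 1 + ‖q k‖ ≤ G k := le_runningMax _
  have hGpos : ∀ k, 0 < G k := fun k => lt_of_lt_of_le (by positivity) (hqG k)
  have hQt : ∀ k, ∀ x ∈ M.terminal, ∀ a, Q k x a = 0 :=
    qSeq_terminal M π μ Γ ε φ₀ Q₀ hQ₀ v
  have hqst : ∀ z : X × A, z.1 ∈ M.terminal → qs z = 0 := fun z hz =>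
    qValue_terminal M _ hB hz z.2
  have hγ : 0 < 1 - M.γ := sub_pos.2 M.γ_lt_one
  -- Expected visits need not be finite at a terminal pair; there `q` and `F` both vanish, so any
  -- positive speed will do.
  set d : X × A → ℝ := fun z => if z.1 ∈ M.terminal then 1 else visits M μ ν z with hd
  have hdpos : ∀ z, 0 < d z := fun z => by
    simp only [hd]
    split_ifs with hz
    · exact one_pos
    · exact visits_pos M μ ν hT hz (hcov z.1 hz z.2)
  set F : ℕ → X × A → ℝ := fun k z => if z.1 ∈ M.terminal then 0 else
    discountedMean M μ (fun z => truncWeight (mix (α k) π μ) μ z.1 z.2)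
      (bellmanResidual M (mix (α k) π μ) (Q k)) z + q k z with hF
  set e : ℕ → ℝ := fun k => |(α k : ℝ) - αs| * (2 * ‖qs‖) / (1 - M.γ) with he
  have he0 : ∀ k, 0 ≤ e k := fun k => by positivity
  have heE : ∀ k, e k ≤ 2 * ‖qs‖ / (1 - M.γ) := fun k => by
    refine div_le_div_of_nonneg_right (mul_le_of_le_one_left (by positivity) ?_) hγ.le
    rw [abs_le]
    constructor <;> linarith [(α k).2.1, (α k).2.2, αs.2.1, αs.2.2]
  have hetend : Tendsto e atTop (𝓝 0) := by
    have h1 : Tendsto (fun k => |(α k : ℝ) - αs|) atTop (𝓝 0) := by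
      have := ((continuous_subtype_val.tendsto αs).comp hα).sub_const (αs : ℝ)
      rw [sub_self] at this
      simpa using this.abs
    simpa using (h1.mul_const (2 * ‖qs‖)).div_const (1 - M.γ)
  have hFq : ∀ k z, |F k z - qs z| ≤ M.γ * ‖q k - qs‖ + e k := fun k z => by
    simp only [hF]
    split_ifs with hz
    · rw [hqst z hz, sub_zero, abs_zero]
      exact add_nonneg (mul_nonneg M.γ_nonneg (norm_nonneg _)) (he0 k)
    · rw [add_sub_assoc]
      exact abs_retrace_sub_qValue_le M π μ hB (α k) αs (Q := Q k)
        (fun z => norm_le_pi_norm (q k - qs) z) (fun z => norm_le_pi_norm qs z) z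
  -- Along the run the running maximum already dominates `1 + ‖Q k‖`, so the normalizing factor is
  -- exactly `G k` and multiplying by it restores the true noise.
  have hnG : ∀ k z, G k * n k z = ε k * (updateSum M (mix (α k) π μ) μ (Q k) (v k) z -
      ∫ τ, updateSum M (mix (α k) π μ) μ (Q k) τ z ∂P) := fun k z => by
    have hmax : max (G k) (1 + pairNorm (Q k)) = G k := max_eq_left (hqG k)
    simp only [hn, normalizedUpdate, hmax]
    rw [integral_div]
    field_simp [(hGpos k).ne']
  have hrec : ∀ k z, q (k + 1) z = q k z + ε k * (d z * (F k z - q k z)) + G k * n k z := by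
    intro k z
    have h1 : q (k + 1) z = q k z + ε k * updateSum M (mix (α k) π μ) μ (Q k) (v k) z := rfl
    rw [hnG, h1]
    by_cases hz : z.1 ∈ M.terminal
    · have h2 : q k z = 0 := hQt k z.1 hz z.2
      have h3 : F k z = 0 := if_pos hz
      rw [h2, h3, updateSum_terminal M _ _ _ _ hz]
      simp_rw [updateSum_terminal M _ _ _ _ hz]
      simp
    · have h3 : F k z - q k z = discountedMean M μ (fun z => truncWeight (mix (α k) π μ) μ z.1 z.2)
          (bellmanResidual M (mix (α k) π μ) (Q k)) z := by
        simp only [hF, if_neg hz, add_sub_cancel_right]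
      have h4 : d z = visits M μ ν z := if_neg hz
      rw [h3, h4, integral_updateSum M _ μ ν hB hT (hQt k) hz]
      ring
  have hbdd : ∃ C, ∀ k, G k ≤ C := by
    refine bounded_of_normalized_noise (q := q) (F := F) (n := n) (d := d) (ε := ε) (γ := M.γ)
      (E := M.γ * ‖qs‖ + 2 * ‖qs‖ / (1 - M.γ) + ‖qs‖) hdpos M.γ_nonneg M.γ_lt_one hε0 hε hqG
      (fun k => le_rfl) (monotone_runningMax _) (fun k z => ?_) hrec hnC
    have h1 := hFq k z
    have h2 : |qs z| ≤ ‖qs‖ := norm_le_pi_norm qs z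
    have h3 := abs_add_le (F k z - qs z) (qs z)
    rw [sub_add_cancel] at h3
    have h4 := mul_le_mul_of_nonneg_left (norm_sub_le (q k) qs) M.γ_nonneg
    have h5 := heE k
    linarith
  obtain ⟨C, hC⟩ := hbdd
  have hx : Tendsto (fun k => q k - qs) atTop (𝓝 0) := by
    refine tendsto_zero_of_contraction (x := fun k => q k - qs) (F := fun k z => F k z - qs z)
      (N := fun k z => G k * n k z) (d := d) (e := e) hdpos M.γ_nonneg M.γ_lt_one hε0 hε hε1 hetend
      he0 hFq (fun k z => ?_)
      fun z => cauchySeq_series_mul_of_monotone_bounded (monotone_runningMax _) hC (hnC z)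
    simp only [Pi.sub_apply, hrec]
    ring
  have hq' : Tendsto q atTop (𝓝 qs) := by simpa using hx.add_const qs
  refine tendsto_pi_nhds.2 fun x => tendsto_pi_nhds.2 fun a => ?_
  exact tendsto_pi_nhds.1 hq' (x, a)

end Convergence

end CTrace

end

/-! ### The theorem -/

open CTrace in
theorem theorem3p5 {X A : Type*} [Fintype X] [Fintype A]
    [MeasurableSpace X] [MeasurableSpace A]
    [MeasurableSingletonClass X] [MeasurableSingletonClass A]
    (M : CTrace.EpisodicMDP X A) (π μ : CTrace.Policy X A) (ν : PMF (X × A))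
    -- the target contraction rate
    (Γ : ℝ) (hΓ0 : 0 < Γ) (hΓ1 : Γ ≤ CTrace.avgContractionRate M π μ ν 1)
    -- the stepsizes
    (ε : ℕ → ℝ) (hε0 : ∀ k, 0 ≤ ε k) (hε1 : ¬ Summable ε) (hε2 : Summable fun k => ε k ^ 2)
    -- trajectory lengths have finite second moment
    (hT : ∫⁻ τ, ((CTrace.trajLength M τ : ℕ∞) : ℝ≥0∞) ^ 2 ∂(CTrace.trajLaw M μ ν) < ∞)
    -- bounded rewards
    (hR : ∃ B : ℝ, ∀ x a, ∀ᵐ r ∂(M.reward x a : Measure ℝ), |r| ≤ B)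
    -- every non-terminal state-action pair is visited with positive probability
    (hcov : ∀ x, x ∉ M.terminal → ∀ a,
      0 < CTrace.trajLaw M μ ν {τ | ∃ t, (τ t).1 = x ∧ (τ t).2.1 = a})
    -- initial values; terminal states have value zero
    (φ₀ : ℝ) (Q₀ : X → A → ℝ) (hQ₀ : ∀ x ∈ M.terminal, ∀ a, Q₀ x a = 0)
    -- an i.i.d. sequence of trajectories following `μ`, started from `ν`
    {Ω : Type*} [MeasurableSpace Ω] (Pr : Measure Ω) [IsProbabilityMeasure Pr]
    (w : ℕ → Ω → CTrace.Traj X A) (hw : ∀ k, Measurable (w k)) (hind : iIndepFun w Pr)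
    (hlaw : ∀ k, Pr.map (w k) = CTrace.trajLaw M μ ν) :
    ∃ αs : I, 0 < αs ∧ CTrace.avgContractionRate M π μ ν αs = Γ ∧
      (∀ β : I, CTrace.avgContractionRate M π μ ν β = Γ → β = αs) ∧
      (Γ < CTrace.avgContractionRate M π μ ν 1 → ∃ φs : ℝ, unitInterval.sigmoid φs = αs ∧
        ∀ φ : ℝ, CTrace.avgContractionRate M π μ ν (unitInterval.sigmoid φ) = Γ → φ = φs) ∧
      ∀ᵐ ω ∂Pr,
        Tendsto (fun k => unitInterval.sigmoid
          (CTrace.phiSeq M π μ Γ ε φ₀ (fun j => w j ω) k)) atTop (𝓝 αs) ∧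
        Tendsto (fun k => CTrace.qSeq M π μ Γ ε φ₀ Q₀ (fun j => w j ω) k) atTop
          (𝓝 (CTrace.qValue M (CTrace.mix αs π μ))) := by
  obtain ⟨B, hB⟩ := hR
  have hmono := strictMono_avgContractionRate M π μ ν (hΓ0.trans_le hΓ1)
  obtain ⟨αs, hαs⟩ : ∃ α, avgContractionRate M π μ ν α = Γ :=
    mem_range_of_exists_le_of_exists_ge (continuous_avgContractionRate M π μ ν)
      ⟨0, by rw [avgContractionRate_zero]; exact hΓ0.le⟩ ⟨1, hΓ1⟩
  have hpos : 0 < αs := by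
    refine lt_of_le_of_ne unitInterval.nonneg' fun h => hΓ0.ne ?_
    rw [← hαs, ← h, avgContractionRate_zero]
  have hε : Tendsto ε atTop (𝓝 0) := by
    have h := (Real.continuous_sqrt.tendsto 0).comp hε2.tendsto_atTop_zero
    rw [Real.sqrt_zero] at h
    exact h.congr fun k => Real.sqrt_sq (hε0 k)
  refine ⟨αs, hpos, hαs, fun β hβ => hmono.injective (hβ.trans hαs.symm), fun hlt => ?_, ?_⟩
  · have h1 : αs < 1 := by
      refine lt_of_le_of_ne unitInterval.le_one' fun h => hlt.ne ?_
      rw [← hαs, h]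
    have h2 : αs ∈ Set.range unitInterval.sigmoid := by
      rw [unitInterval.range_sigmoid]; exact ⟨hpos, h1⟩
    obtain ⟨φs, hφs⟩ := h2
    refine ⟨φs, hφs, fun φ hφ => unitInterval.sigmoid_injective (hmono.injective ?_)⟩
    rw [hφ, hφs, hαs]
  have hφm := measurable_phiSeq M π μ Γ ε φ₀ hw
  have hQm := measurable_qSeq M π μ Γ ε φ₀ Q₀ hw
  have hαm : ∀ k, Measurable[pastFiltration w hw k] fun ω =>
      unitInterval.sigmoid (phiSeq M π μ Γ ε φ₀ (fun j => w j ω) k) := fun k =>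
    unitInterval.continuous_sigmoid.measurable.comp (hφm k)
  have hNm : ∀ k, Measurable[pastFiltration w hw k] fun ω =>
      1 + pairNorm (qSeq M π μ Γ ε φ₀ Q₀ (fun j => w j ω) k) := fun k =>
    measurable_const.add (measurable_pairNorm.comp (hQm k))
  have hGm : ∀ k, Measurable[pastFiltration w hw k] fun ω => runningMax
      (fun k => 1 + pairNorm (qSeq M π μ Γ ε φ₀ Q₀ (fun j => w j ω) k)) k := fun k => by
    induction k with
    | zero => exact hNm 0
    | succ k ih => exact (ih.mono ((pastFiltration w hw).mono k.le_succ) le_rfl).max (hNm (k + 1))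
  have hφnoise := ae_exists_tendsto_noise hw hind hlaw hαm (measurable_uncurry_contractionEst M π μ)
    (b := fun _ => 2) measurable_const
    (fun α => ae_of_all _ fun τ => abs_contractionEst_le M π μ α τ) (memLp_const 2) hε2
  have hb2 : MemLp (fun τ => ((trajLength M τ).toNat : ℝ) * ((B + 2) / (1 - M.γ))) 2
      (trajLaw M μ ν) := (memLp_trajLength M hT).mul_const _
  -- The running maximum is part of the state: it is determined by the past, so the normalized noise
  -- is still a martingale difference.
  have hQnoise : ∀ᵐ ω ∂Pr, ∀ z : X × A, _ := ae_all_iff.2 fun z =>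
    ae_exists_tendsto_noise hw hind hlaw (fun k => ((hαm k).prodMk (hQm k)).prodMk (hGm k))
      (measurable_normalizedUpdate M π μ z)
      ((measurable_from_top.comp (measurable_trajLength_toNat M)).mul_const _)
      (fun s => (ae_reward_bound M μ ν hB).mono fun τ hτ => abs_normalizedUpdate_le M π μ z s hτ)
      hb2 hε2
  filter_upwards [hφnoise, hQnoise] with ω hω1 hω2
  have hα : Tendsto (fun k => unitInterval.sigmoid
      (phiSeq M π μ Γ ε φ₀ (fun j => w j ω) k)) atTop (𝓝 αs) := by
    obtain ⟨L, hL⟩ := hω1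
    refine tendsto_sigmoid_of_robbinsMonro (N := fun k => -(ε k * (contractionEst M π μ
      (unitInterval.sigmoid (phiSeq M π μ Γ ε φ₀ (fun j => w j ω) k)) (w k ω) -
        ∫ τ, contractionEst M π μ
          (unitInterval.sigmoid (phiSeq M π μ Γ ε φ₀ (fun j => w j ω) k)) τ ∂trajLaw M μ ν)))
      (L := -L) (K := 2 + |Γ|) hmono hαs (fun α => ?_) hε0 hε hε1 ?_ fun k => ?_
    · refine (abs_sub _ _).trans (add_le_add_left ?_ _)
      rw [← integral_contractionEst]
      have := norm_integral_le_of_norm_le_const (μ := trajLaw M μ ν)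
        (ae_of_all _ fun τ => (Real.norm_eq_abs _).le.trans (abs_contractionEst_le M π μ α τ))
      simpa using this
    · simpa using hL.neg
    · rw [phiSeq, integral_contractionEst]
      ring
  exact ⟨hα, tendsto_qSeq M π μ ν hε0 hε hε1 hT hB hcov hQ₀ _ hα hω2⟩
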